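/- Let $\mathbb{K}$ be a (commutative) field of characteristic zero. **Preordered forests.** A rooted forest $F$ is a finite graph each of whose connected components is a rooted tree; $V(F)$ is its set of vertices, its edges are oriented towards the roots, and $v \twoheadrightarrow w$ means that there is an oriented path (possibly of length $0$) from $v$ down to $w$. A preordered forest is a rooted forest $F$ with a total preorder on $V(F)$ (considered up to isomorphism). If $q = \max(F)$ is the number of classes of the equivalence relation "$x \le y$ and $y \le x$", the preorder is encoded by the unique surjection $\sigma : V(F) \to \{1,\dots,q\}$ such that $\sigma(v) \le \sigma(w) \iff v \le w$, and we write $(F,\sigma)$. Let $\mathbf{H}_{po}$ be the $\mathbb{K}$-vector space with basis the preordered forests, graded by the number of vertices. It is a graded Hopf algebra. Its product is $(F,\sigma^F)(G,\sigma^G) = (FG, \sigma^{FG})$, where $FG$ is the disjoint union, $\sigma^{FG} = \sigma^F$ on $V(F)$ and $\sigma^{FG} = \sigma^G + \max(F)$ on $V(G)$; the unit is the empty forest. Its coproduct is $$\Delta(F) = \sum_{\boldsymbol{v}} Lea_{\boldsymbol{v}}(F) \otimes Roo_{\boldsymbol{v}}(F),$$ where $\boldsymbol{v}$ runs over the admissible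 cuts of $F$, i.e. the subsets of $V(F)$ such that $v \twoheadrightarrow w$ holds for no two different elements $v,w$ of $\boldsymbol{v}$; $Lea_{\boldsymbol{v}}(F)$ is the subforest on the vertices $w$ such that $w \twoheadrightarrow v$ for some $v \in \boldsymbol{v}$, and $Roo_{\boldsymbol{v}}(F)$ is the subforest on the other vertices, both with the restricted preorder. **Packed words.** For $n \ge 0$, $Surj_n$ is the set of maps $\tau : \{1,\dots,n\} \to \mathbb{N}^*$ with image $\{1,\dots,k\}$ for some $k = \max(\tau) \in \mathbb{N}$, written as packed words $(\tau(1) \dots \tau(n))$. The packing of a word with letters $a_1 < \dots < a_k$ is obtained by replacing each letter $a_i$ by $i$. Let $\mathbf{WQSym}^*$ be the $\mathbb{K}$-vector space with basis $\bigsqcup_{n \ge 0} Surj_n$, graded by the length $n$. It is a graded Hopf algebra. The product of $\sigma \in Surj_k$ and $\tau \in Surj_l$ is the sum of the $\binom{k+l}{k}$ shufflings of the word $\sigma$ and of the word $\tau$ whose letters have been increased by $\max(\sigma)$; the unit is the empty word. The coproduct of $\sigma \in Surj_n$ is $\sum_{k=0}^n \sigma_1^{(k)} \otimes \sigma_2^{(k)}$,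 where $\sigma_1^{(k)}$ and $\sigma_2^{(k)}$ are the packings of $(\sigma(1)\dots\sigma(k))$ and of $(\sigma(k+1)\dots\sigma(n))$. **Theorem.** For a preordered forest $(F,\sigma)$ with $n$ vertices and $\tau \in Surj_n$, let $\mathbb{S}^{\tau}_{(F,\sigma)}$ be the set of bijections $\varphi : V(F) \to \{1,\dots,n\}$ such that 1. $\sigma(v) = \tau(\varphi(v))$ for all $v \in V(F)$; 2. $\varphi(v) \ge \varphi(v')$ for all $v, v' \in V(F)$ with $v' \twoheadrightarrow v$. Let $\Phi : \mathbf{H}_{po} \to \mathbf{WQSym}^*$ be the linear map such that, for every preordered forest $(F,\sigma)$ with $n$ vertices, $$\Phi((F,\sigma)) = \sum_{\tau \in Surj_n} \mathrm{card}\big(\mathbb{S}^{\tau}_{(F,\sigma)}\big)\, \tau .$$ Then $\Phi$ is a Hopf algebra morphism (it is compatible with the products, the units, the coproducts, the counits and the antipodes), and it is homogeneous of degree $0$: it maps the component of degree $n$ of $\mathbf{H}_{po}$ into the component of degree $n$ of $\mathbf{WQSym}^*$ for every $n$. -/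

import Mathlib

open scoped TensorProduct

/-- A basis `B` of a connected graded Hopf algebra whose structure constants are natural numbers:
`mul a b` is the multiset of terms of the product of two basis elements, `comul b` is the multiset
of terms of the coproduct of a basis element, `deg b` is its degree. -/
class HopfBasis (B : Type) where
  one : B
  mul : B → B → Multiset B
  comul : B → Multiset (B × B)
  deg : B → ℕ
  one_mul : ∀ b, mul one b = {b}
  mul_one : ∀ b, mul b one = {b}
  mul_assoc : ∀ a b c, (mul a b).bind (fun x => mul x c) = (mul b c).bind (fun y => mul a y)
  comul_one : comul one = {(one, one)}
  comul_mul : ∀ a b, (mul a b).bind comul =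
    (comul a).bind fun p => (comul b).bind fun q =>
      (mul p.1 q.1).bind fun x => (mul p.2 q.2).map fun y => (x, y)
  coassoc : ∀ b, ((comul b).bind fun p => (comul p.1).map fun q => (q.1, q.2, p.2)) =
    (comul b).bind fun p => (comul p.2).map fun q => (p.1, q.1, q.2)
  filter_left : ∀ b, ((comul b).filter fun p => deg p.1 = 0) = {(one, b)}
  filter_right : ∀ b, ((comul b).filter fun p => deg p.2 = 0) = {(b, one)}
  deg_eq_zero : ∀ b, deg b = 0 ↔ b = one
  deg_mul : ∀ a b, ∀ x ∈ mul a b, deg x = deg a + deg b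
  deg_comul : ∀ b, ∀ p ∈ comul b, deg p.1 + deg p.2 = deg b

/-- The `K`-vector space with basis `B`. -/
def CombAlg (K B : Type*) [Zero K] : Type _ := B →₀ K

namespace CombAlg

noncomputable section

variable {K : Type*} [CommRing K] {B : Type}

instance : AddCommGroup (CombAlg K B) := inferInstanceAs (AddCommGroup (B →₀ K))
instance : Module K (CombAlg K B) := inferInstanceAs (Module K (B →₀ K))

/-- The element of `CombAlg K B` given by the basis element `b`. -/
def of (b : B) : CombAlg K B := Finsupp.single b 1

/-- Linear extension of a map defined on the basis. -/
def lift {M : Type*} [AddCommMonoid M] [Module K M] (f : B → M) : CombAlg K B →ₗ[K] M :=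
  Finsupp.linearCombination K f

@[simp] theorem lift_of {M : Type*} [AddCommMonoid M] [Module K M] (f : B → M) (b : B) :
    lift (K := K) f (of b) = f b := by
  exact (Finsupp.linearCombination_single K (1 : K) b).trans (one_smul K _)

theorem hom_ext {M : Type*} [AddCommMonoid M] [Module K M] {f g : CombAlg K B →ₗ[K] M}
    (h : ∀ b, f (of b) = g (of b)) : f = g :=
  Finsupp.lhom_ext' fun b => LinearMap.ext_ring (h b)

/-- The sum of the basis elements in a multiset. -/
def ofM (m : Multiset B) : CombAlg K B := (m.map of).sum

/-- The sum of `x ⊗ y` over the pairs `(x, y)` in a multiset. -/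
def ofM₂ (m : Multiset (B × B)) : CombAlg K B ⊗[K] CombAlg K B :=
  (m.map fun p => of p.1 ⊗ₜ[K] of p.2).sum

theorem map_ofM {M : Type*} [AddCommMonoid M] [Module K M] (f : CombAlg K B →ₗ[K] M)
    (m : Multiset B) : f (ofM m) = (m.map fun b => f (of b)).sum := by
  rw [ofM, map_multiset_sum, Multiset.map_map]; rfl

theorem map_ofM₂ {M : Type*} [AddCommMonoid M] [Module K M]
    (f : CombAlg K B ⊗[K] CombAlg K B →ₗ[K] M) (m : Multiset (B × B)) :
    f (ofM₂ m) = (m.map fun p => f (of p.1 ⊗ₜ of p.2)).sum := by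
  rw [ofM₂, map_multiset_sum, Multiset.map_map]; rfl

theorem ofM_bind {C : Type*} (m : Multiset C) (f : C → Multiset B) :
    (ofM (m.bind f) : CombAlg K B) = (m.map fun c => ofM (f c)).sum := by
  simp [ofM, Multiset.map_bind, Multiset.sum_bind]

theorem ofM₂_bind {C : Type*} (m : Multiset C) (f : C → Multiset (B × B)) :
    (ofM₂ (m.bind f) : CombAlg K B ⊗[K] CombAlg K B) = (m.map fun c => ofM₂ (f c)).sum := by
  simp [ofM₂, Multiset.map_bind, Multiset.sum_bind]

@[simp] theorem ofM_singleton (b : B) : (ofM {b} : CombAlg K B) = of b := by simp [ofM]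

theorem induction {P : CombAlg K B → Prop} (h0 : P 0) (ha : ∀ x y, P x → P y → P (x + y))
    (hs : ∀ (r : K) x, P x → P (r • x)) (hof : ∀ b, P (of b)) (x : CombAlg K B) : P x := by
  refine Finsupp.induction_linear (motive := P) x h0 ha fun b r => ?_
  have h := hs r _ (hof b)
  have e : (r • of b : CombAlg K B) = Finsupp.single b r := by
    refine (Finsupp.smul_single r b 1).trans ?_
    rw [smul_eq_mul, _root_.mul_one]
  rwa [e] at h

variable [HopfBasis B]

/-- The bilinear product, `a * b` being the sum of the multiset `mul a b` on basis elements. -/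
def mulHom : CombAlg K B →ₗ[K] CombAlg K B →ₗ[K] CombAlg K B :=
  lift fun a => lift fun b => ofM (HopfBasis.mul a b)

@[simp] theorem mulHom_of (a b : B) :
    mulHom (K := K) (of a) (of b) = ofM (HopfBasis.mul a b) := by
  simp [mulHom]

instance : Mul (CombAlg K B) := ⟨fun x y => mulHom x y⟩
instance : One (CombAlg K B) := ⟨of HopfBasis.one⟩

theorem mul_def (x y : CombAlg K B) : x * y = mulHom x y := rfl
theorem one_def : (1 : CombAlg K B) = of HopfBasis.one := rfl

theorem of_mul_of (a b : B) : (of a * of b : CombAlg K B) = ofM (HopfBasis.mul a b) :=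
  mulHom_of a b

theorem mulHom_ofM_of (m : Multiset B) (c : B) :
    mulHom (K := K) (ofM m) (of c) = ofM (m.bind fun x => HopfBasis.mul x c) := by
  rw [ofM_bind, ← LinearMap.flip_apply, map_ofM]
  simp

theorem mulHom_of_ofM (a : B) (m : Multiset B) :
    mulHom (K := K) (of a) (ofM m) = ofM (m.bind fun y => HopfBasis.mul a y) := by
  rw [ofM_bind, map_ofM]
  simp

theorem mulHom_assoc (x y z : CombAlg K B) :
    mulHom (mulHom x y) z = mulHom x (mulHom y z) := by
  induction x using induction with
  | h0 => simp
  | ha x x' h h' => simp [h, h']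
  | hs r x h => simp [h]
  | hof a =>
    induction y using induction with
    | h0 => simp
    | ha x x' h h' => simp [h, h']
    | hs r x h => simp [h]
    | hof b =>
      induction z using induction with
      | h0 => simp
      | ha x x' h h' => rw [map_add, map_add, map_add, h, h']
      | hs r x h => rw [map_smul, map_smul, map_smul, h]
      | hof c =>
        rw [mulHom_of, mulHom_of, mulHom_ofM_of, mulHom_of_ofM, HopfBasis.mul_assoc]

instance : Ring (CombAlg K B) :=
  { (inferInstance : AddCommGroup (CombAlg K B)) with
    left_distrib := fun x y z => by simp [mul_def]
    right_distrib := fun x y z => by simp [mul_def]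
    zero_mul := fun x => by simp [mul_def]
    mul_zero := fun x => by simp [mul_def]
    one_mul := fun x => by
      have : mulHom (K := K) (of (HopfBasis.one : B)) = LinearMap.id :=
        hom_ext fun b => by simp [HopfBasis.one_mul]
      exact congr($this x)
    mul_one := fun x => by
      have : (mulHom (K := K)).flip (of (HopfBasis.one : B)) = LinearMap.id :=
        hom_ext fun b => by simp [HopfBasis.mul_one]
      exact congr($this x)
    mul_assoc := mulHom_assoc }

instance : Algebra K (CombAlg K B) :=
  Algebra.ofModule (fun r x y => by simp [mul_def]) (fun r x y => by simp [mul_def])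

/-- The coproduct, `Δ(b)` being the sum of the tensors in `comul b` on basis elements; the counit is
the coefficient of the unit. -/
instance : CoalgebraStruct K (CombAlg K B) where
  comul := lift fun b => ofM₂ (HopfBasis.comul b)
  counit := lift fun b => if HopfBasis.deg b = 0 then 1 else 0

open Coalgebra

@[simp] theorem comul_of (b : B) :
    comul (R := K) (of b : CombAlg K B) = ofM₂ (HopfBasis.comul b) := lift_of _ _

@[simp] theorem counit_of (b : B) :
    counit (R := K) (of b : CombAlg K B) = if HopfBasis.deg b = 0 then 1 else 0 := lift_of _ _

theorem sum_map_ite {M C : Type*} [AddCommMonoid M] (m : Multiset C) (p : C → Prop)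
    [DecidablePred p] (f : C → M) :
    (m.map fun c => if p c then f c else 0).sum = ((m.filter p).map f).sum := by
  induction m using Multiset.induction with
  | empty => simp
  | cons a m ih => by_cases h : p a <;> simp [h, ih]

instance : Coalgebra K (CombAlg K B) where
  coassoc := hom_ext fun b => by
    have h := congrArg (fun m => (m.map fun q : B × B × B =>
      (of q.1 : CombAlg K B) ⊗ₜ[K] ((of q.2.1 : CombAlg K B) ⊗ₜ[K] (of q.2.2 : CombAlg K B))).sum)
      (HopfBasis.coassoc b)
    simp only [Multiset.map_bind, Multiset.sum_bind, Multiset.map_map, Function.comp_def] at h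
    simp only [LinearMap.comp_apply, comul_of, map_ofM₂, LinearEquiv.coe_coe,
      LinearMap.rTensor_tmul, LinearMap.lTensor_tmul, map_multiset_sum, Multiset.map_map,
      Function.comp_def]
    convert h using 4 with p hp p hp
    · exact map_ofM₂ ((TensorProduct.assoc K _ _ _).toLinearMap ∘ₗ
        (TensorProduct.mk K _ _).flip (of p.2)) _
    · exact map_ofM₂ (TensorProduct.mk K _ _ (of p.1)) _
  rTensor_counit_comp_comul := hom_ext fun b => by
    simp only [LinearMap.comp_apply, comul_of, map_ofM₂, LinearMap.rTensor_tmul, counit_of,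
      TensorProduct.ite_tmul]
    rw [sum_map_ite _ (fun p : B × B => HopfBasis.deg p.1 = 0), HopfBasis.filter_left]
    simp
  lTensor_counit_comp_comul := hom_ext fun b => by
    simp only [LinearMap.comp_apply, comul_of, map_ofM₂, LinearMap.lTensor_tmul, counit_of,
      TensorProduct.tmul_ite]
    rw [sum_map_ite _ (fun p : B × B => HopfBasis.deg p.2 = 0), HopfBasis.filter_right]
    simp

theorem counit_mul (x y : CombAlg K B) :
    counit (R := K) (x * y) = counit (R := K) x * counit (R := K) y := by
  induction x using induction with
  | h0 => simp
  | ha x x' h h' => simp [h, h', add_mul]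
  | hs r x h => simp [h, _root_.mul_assoc]
  | hof a =>
    induction y using induction with
    | h0 => simp
    | ha x x' h h' => simp [h, h', mul_add]
    | hs r x h => simp [h]
    | hof b =>
      rw [of_mul_of, map_ofM]
      by_cases ha : HopfBasis.deg a = 0
      · rw [(HopfBasis.deg_eq_zero a).1 ha, HopfBasis.one_mul]
        simp [(HopfBasis.deg_eq_zero (HopfBasis.one : B)).2 rfl]
      · rw [counit_of a, if_neg ha, zero_mul]
        refine Multiset.sum_eq_zero fun x hx => ?_
        obtain ⟨c, hc, rfl⟩ := Multiset.mem_map.1 hx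
        have := HopfBasis.deg_mul a b c hc
        rw [counit_of, if_neg (by omega)]

theorem ofM₂_mul_ofM₂ (m n : Multiset (B × B)) :
    (ofM₂ m * ofM₂ n : CombAlg K B ⊗[K] CombAlg K B) =
      ofM₂ (m.bind fun p => n.bind fun q => (HopfBasis.mul p.1 q.1).bind fun x =>
        (HopfBasis.mul p.2 q.2).map fun y => (x, y)) := by
  rw [ofM₂_bind, ofM₂, ← Multiset.sum_map_mul_right]
  congr 1
  refine Multiset.map_congr rfl fun p _ => ?_
  rw [ofM₂_bind, ofM₂, ← Multiset.sum_map_mul_left]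
  congr 1
  refine Multiset.map_congr rfl fun q _ => ?_
  rw [Algebra.TensorProduct.tmul_mul_tmul, of_mul_of, of_mul_of, ofM₂_bind]
  refine (map_ofM ((TensorProduct.mk K _ _).flip (ofM (HopfBasis.mul p.2 q.2))) _).trans ?_
  congr 1
  refine Multiset.map_congr rfl fun x _ => ?_
  refine (map_ofM (TensorProduct.mk K _ _ (of x)) _).trans ?_
  rw [ofM₂, Multiset.map_map]
  rfl

theorem comul_mul (x y : CombAlg K B) :
    comul (R := K) (x * y) = comul (R := K) x * comul (R := K) y := by
  induction x using induction with
  | h0 => simp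
  | ha x x' h h' => simp [h, h', add_mul]
  | hs r x h =>
    rw [smul_mul_assoc, map_smul, map_smul, h]
    exact (smul_mul_assoc r _ _).symm
  | hof a =>
    induction y using induction with
    | h0 => simp
    | ha x x' h h' => simp [h, h', mul_add]
    | hs r x h =>
      rw [mul_smul_comm, map_smul, map_smul, h]
      exact (mul_smul_comm r _ _).symm
    | hof b =>
      rw [of_mul_of, map_ofM, comul_of, comul_of, ofM₂_mul_ofM₂, ← HopfBasis.comul_mul, ofM₂_bind]
      simp

instance : Bialgebra K (CombAlg K B) :=
  Bialgebra.mk' K (CombAlg K B)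
    (by
      rw [one_def]
      exact (counit_of _).trans (if_pos ((HopfBasis.deg_eq_zero _).2 rfl)))
    (counit_mul _ _)
    (by
      rw [one_def]
      refine (comul_of _).trans ?_
      rw [HopfBasis.comul_one, ofM₂, Multiset.map_singleton, Multiset.sum_singleton]
      rfl)
    (comul_mul _ _)

/-- The endomorphism `1 - id` for the convolution product, where `1 = η ∘ ε`. -/
def aug (K : Type*) [CommRing K] (B : Type) [HopfBasis B] :
    WithConv (CombAlg K B →ₗ[K] CombAlg K B) := 1 - WithConv.toConv LinearMap.id

theorem conv_apply_of (f g : WithConv (CombAlg K B →ₗ[K] CombAlg K B)) (b : B) :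
    (f * g) (of b) = ((HopfBasis.comul b).map fun p => f (of p.1) * g (of p.2)).sum := by
  rw [LinearMap.convMul_apply, comul_of, map_ofM₂, map_multiset_sum, Multiset.map_map]
  simp [Function.comp_def]

theorem aug_of {b : B} (hb : HopfBasis.deg b = 0) : aug K B (of b) = 0 := by
  change algebraMap K (CombAlg K B) (counit (R := K) (of b : CombAlg K B)) - of b = 0
  rw [counit_of, if_pos hb, map_one, (HopfBasis.deg_eq_zero b).1 hb]
  exact sub_self _

theorem aug_pow_of (n : ℕ) {b : B} (hb : HopfBasis.deg b < n) :
    (aug K B ^ n) (of b) = 0 := by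
  induction n generalizing b with
  | zero => omega
  | succ n ih =>
    rw [pow_succ', conv_apply_of]
    refine Multiset.sum_eq_zero fun x hx => ?_
    obtain ⟨p, hp, rfl⟩ := Multiset.mem_map.1 hx
    have h := HopfBasis.deg_comul b p hp
    by_cases h0 : HopfBasis.deg p.1 = 0
    · rw [aug_of h0, zero_mul]
    · rw [ih (by omega), mul_zero]

/-- The antipode, given by the geometric series `∑ (1 - id)^{*n}`, which is finite on each basis
element. -/
def antipodeHom : CombAlg K B →ₗ[K] CombAlg K B :=
  lift fun b => ∑ n ∈ Finset.range (HopfBasis.deg b + 1),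
    (aug K B ^ n) (of b)

theorem antipodeHom_of {b : B} {N : ℕ} (h : HopfBasis.deg b < N) :
    antipodeHom (K := K) (of b) = (∑ n ∈ Finset.range N,
      aug K B ^ n) (of b) := by
  have e : ∀ s : Finset ℕ, (∑ n ∈ s, aug K B ^ n) (of b) =
      ∑ n ∈ s, (aug K B ^ n) (of b) := by
    intro s
    induction s using Finset.induction with
    | empty => rfl
    | insert a s ha ih =>
      rw [Finset.sum_insert ha, Finset.sum_insert ha, ← ih]
      rfl
  rw [e, antipodeHom, lift_of]
  have hs : Finset.range (HopfBasis.deg b + 1) ⊆ Finset.range N := Finset.range_subset_range.2 h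
  refine Finset.sum_subset hs fun n _ hn => aug_pow_of n ?_
  have := mt Finset.mem_range.2 hn
  omega

theorem geom_conv_of (b : B) :
    ((∑ n ∈ Finset.range (HopfBasis.deg b + 1),
      aug K B ^ n) * (1 - aug K B)) (of b) =
      algebraMap K (CombAlg K B) (counit (R := K) (of b : CombAlg K B)) := by
  rw [geom_sum_mul_neg]
  change algebraMap K (CombAlg K B) (counit (R := K) (of b : CombAlg K B)) -
    (aug K B ^ (HopfBasis.deg b + 1)) (of b) = _
  rw [aug_pow_of _ (Nat.lt_succ_self _), sub_zero]

theorem conv_geom_of (b : B) :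
    ((1 - aug K B) * (∑ n ∈ Finset.range (HopfBasis.deg b + 1),
      aug K B ^ n)) (of b) =
      algebraMap K (CombAlg K B) (counit (R := K) (of b : CombAlg K B)) := by
  rw [mul_neg_geom_sum]
  change algebraMap K (CombAlg K B) (counit (R := K) (of b : CombAlg K B)) -
    (aug K B ^ (HopfBasis.deg b + 1)) (of b) = _
  rw [aug_pow_of _ (Nat.lt_succ_self _), sub_zero]

theorem one_sub_aug : (1 - aug K B : WithConv (CombAlg K B →ₗ[K] CombAlg K B)) =
    WithConv.toConv LinearMap.id := by
  simp [aug]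

instance : HopfAlgebra K (CombAlg K B) where
  antipode := antipodeHom
  mul_antipode_rTensor_comul := hom_ext fun b => by
    refine Eq.trans ?_ (geom_conv_of b)
    rw [one_sub_aug, conv_apply_of, LinearMap.comp_apply, LinearMap.comp_apply, comul_of,
      map_ofM₂, map_multiset_sum, Multiset.map_map]
    congr 1
    refine Multiset.map_congr rfl fun p hp => ?_
    have h := HopfBasis.deg_comul b p hp
    simp [antipodeHom_of (K := K) (b := p.1) (N := HopfBasis.deg b + 1) (by omega)]
  mul_antipode_lTensor_comul := hom_ext fun b => by
    refine Eq.trans ?_ (conv_geom_of b)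
    rw [one_sub_aug, conv_apply_of, LinearMap.comp_apply, LinearMap.comp_apply, comul_of,
      map_ofM₂, map_multiset_sum, Multiset.map_map]
    congr 1
    refine Multiset.map_congr rfl fun p hp => ?_
    have h := HopfBasis.deg_comul b p hp
    simp [antipodeHom_of (K := K) (b := p.2) (N := HopfBasis.deg b + 1) (by omega)]

/-- The homogeneous component of degree `n`, spanned by the basis elements of degree `n`. -/
def component (K : Type*) [CommRing K] (B : Type) [HopfBasis B] (n : ℕ) :
    Submodule K (CombAlg K B) :=
  Submodule.span K (of '' {b : B | HopfBasis.deg b = n})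

end

end CombAlg

/-- The shufflings of two words of lengths `k` and `l`, with multiplicities: each of the
`(k, l)`-shuffles, i.e. each choice of the `k` positions occupied by the letters of the first word,
contributes one word. -/
def shuffle : List ℕ → List ℕ → Multiset (List ℕ)
  | [], v => {v}
  | a :: u, [] => {a :: u}
  | a :: u, b :: v =>
      (shuffle u (b :: v)).map (List.cons a) + (shuffle (a :: u) v).map (List.cons b)
  termination_by u v => u.length + v.length

/-- All ways to cut a word into a prefix and a suffix. -/
def splits (w : List ℕ) : Multiset (List ℕ × List ℕ) :=
  (Multiset.range (w.length + 1)).map fun k => (w.take k, w.drop k)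

/-- A word is packed if its set of letters is `{1, …, k}` for some `k`. -/
def IsPacked (w : List ℕ) : Prop := ∃ k, w.toFinset = Finset.Icc 1 k

/-- The largest letter of a word (`0` for the empty word). -/
def maxLetter (w : List ℕ) : ℕ := w.toFinset.sup id

/-- If the elements of `s` are `a₁ < ⋯ < aₖ`, then `rankIn s aᵢ = i`. -/
def rankIn (s : Finset ℕ) (a : ℕ) : ℕ := (s.filter (· ≤ a)).card

/-- The packing of a word: if its letters are `a₁ < ⋯ < aₖ`, each letter `aᵢ` is replaced by `i`. -/
def pack (w : List ℕ) : List ℕ := w.map (rankIn w.toFinset)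

namespace WordLemmas

@[simp] theorem shuffle_nil_left (v : List ℕ) : shuffle [] v = {v} := by
  rw [shuffle]

@[simp] theorem shuffle_nil_right (u : List ℕ) : shuffle u [] = {u} := by
  cases u <;> rw [shuffle]

theorem shuffle_cons (a : ℕ) (u : List ℕ) (b : ℕ) (v : List ℕ) :
    shuffle (a :: u) (b :: v) =
      (shuffle u (b :: v)).map (List.cons a) + (shuffle (a :: u) v).map (List.cons b) := by
  rw [shuffle]

theorem shuffle_map (g : ℕ → ℕ) (u v : List ℕ) :
    shuffle (u.map g) (v.map g) = (shuffle u v).map (List.map g) := by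
  induction u generalizing v with
  | nil => simp
  | cons a u ihu =>
    induction v with
    | nil => simp
    | cons b v ihv =>
      have h1 := ihu (b :: v)
      simp only [List.map_cons] at h1 ihv ⊢
      rw [shuffle_cons, shuffle_cons, h1, ihv]
      simp [Multiset.map_map]

theorem perm_of_mem_shuffle {u v w : List ℕ} (h : w ∈ shuffle u v) : w.Perm (u ++ v) := by
  induction u generalizing v w with
  | nil => simp at h; simp [h]
  | cons a u ihu =>
    induction v generalizing w with
    | nil => simp at h; simp [h]
    | cons b v ihv =>
      rw [shuffle_cons, Multiset.mem_add, Multiset.mem_map, Multiset.mem_map] at h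
      rcases h with ⟨x, hx, rfl⟩ | ⟨x, hx, rfl⟩
      · exact (ihu hx).cons a
      · exact ((ihv hx).cons b).trans List.perm_middle.symm

theorem bind_self {α : Type*} (m : Multiset α) : (m.bind fun a => {a}) = m := by
  simpa using Multiset.bind_singleton m id

theorem shuffle_assoc (u v x : List ℕ) :
    (shuffle u v).bind (fun w => shuffle w x) = (shuffle v x).bind (fun w => shuffle u w) := by
  induction u generalizing v x with
  | nil => simp [bind_self]
  | cons a u ihu =>
    induction v generalizing x with
    | nil => simp
    | cons b v ihv =>
      induction x with
      | nil => simp [bind_self]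
      | cons c x ihx =>
        have h1 := ihu (b :: v) (c :: x)
        have h2 := ihv (c :: x)
        rw [shuffle_cons, Multiset.add_bind, Multiset.bind_map, Multiset.bind_map] at ihx ⊢
        rw [shuffle_cons, Multiset.add_bind, Multiset.bind_map, Multiset.bind_map]
        rw [shuffle_cons b v c x, Multiset.add_bind, Multiset.bind_map, Multiset.bind_map] at h1
        simp only [shuffle_cons, Multiset.bind_add, ← Multiset.map_bind] at h2 ⊢
        rw [h1, h2, ← ihx]
        simp only [Multiset.map_add]
        abel

theorem splits_nil : splits [] = {([], [])} := by simp [splits]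

theorem splits_cons (a : ℕ) (w : List ℕ) :
    splits (a :: w) = {([], a :: w)} + (splits w).map fun p => (a :: p.1, p.2) := by
  have h : Multiset.range (w.length + 1 + 1) =
      {0} + (Multiset.range (w.length + 1)).map Nat.succ := by
    rw [Multiset.range, List.range_succ_eq_map]
    rfl
  rw [splits, List.length_cons, h, Multiset.map_add, Multiset.map_map, splits, Multiset.map_map]
  simp [Function.comp_def]

theorem splits_map (g : ℕ → ℕ) (w : List ℕ) :
    splits (w.map g) = (splits w).map fun p => (p.1.map g, p.2.map g) := by
  simp [splits, Multiset.map_map, List.map_take, List.map_drop]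

theorem append_of_mem_splits {w : List ℕ} {p : List ℕ × List ℕ} (h : p ∈ splits w) :
    p.1 ++ p.2 = w := by
  obtain ⟨k, _, rfl⟩ := Multiset.mem_map.1 h
  simp

theorem filter_splits_left (w : List ℕ) :
    (splits w).filter (fun p => p.1.length = 0) = {([], w)} := by
  cases w with
  | nil => simp [splits_nil]
  | cons a w => simp [splits_cons, Multiset.filter_map]

theorem filter_splits_right (w : List ℕ) :
    (splits w).filter (fun p => p.2.length = 0) = {(w, [])} := by
  induction w with
  | nil => simp [splits_nil]
  | cons a w ih =>
    rw [splits_cons, Multiset.filter_add, Multiset.filter_map]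
    simp only [Function.comp_def]
    rw [ih]
    simp

theorem splits_coassoc (w : List ℕ) :
    ((splits w).bind fun p => (splits p.1).map fun q => (q.1, q.2, p.2)) =
      (splits w).bind fun p => (splits p.2).map fun q => (p.1, q.1, q.2) := by
  induction w with
  | nil => simp [splits_nil]
  | cons a w ih =>
    have h := congrArg (Multiset.map fun t : List ℕ × List ℕ × List ℕ => (a :: t.1, t.2)) ih
    simp only [Multiset.map_bind, Multiset.map_map, Function.comp_def] at h
    simp only [splits_cons, Multiset.add_bind, Multiset.singleton_bind, Multiset.bind_map,
      splits_nil, Multiset.map_singleton, Multiset.map_add, Multiset.bind_add, Multiset.map_map,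
      Function.comp_def, h, Multiset.bind_singleton]
    abel

theorem splits_shuffle (u v : List ℕ) :
    (shuffle u v).bind splits =
      (splits u).bind fun p => (splits v).bind fun q =>
        (shuffle p.1 q.1).bind fun x => (shuffle p.2 q.2).map fun y => (x, y) := by
  induction u generalizing v with
  | nil => simp [splits_nil, bind_self]
  | cons a u ihu =>
    induction v with
    | nil => simp [splits_nil, bind_self]
    | cons b v ihv =>
      have h1 := congrArg (Multiset.map fun t : List ℕ × List ℕ => (a :: t.1, t.2)) (ihu (b :: v))
      have h2 := congrArg (Multiset.map fun t : List ℕ × List ℕ => (b :: t.1, t.2)) ihv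
      simp only [splits_cons, Multiset.add_bind, Multiset.singleton_bind, Multiset.bind_map,
        Multiset.map_bind, Multiset.map_map, Function.comp_def, shuffle_nil_left,
        shuffle_nil_right, Multiset.map_add, Multiset.bind_add, Multiset.bind_singleton,
        shuffle_cons] at h1 h2 ⊢
      rw [h1, h2]
      abel

/-! Packing -/

theorem rankIn_strictMonoOn (s : Finset ℕ) {a b : ℕ} (hb : b ∈ s) (h : a < b) :
    rankIn s a < rankIn s b := by
  refine Finset.card_lt_card (Finset.ssubset_iff_of_subset (fun x hx => ?_) |>.2 ⟨b, ?_, ?_⟩)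
  · simp only [Finset.mem_filter] at hx ⊢
    exact ⟨hx.1, hx.2.trans h.le⟩
  · simp [hb]
  · simp [h]

theorem image_rankIn (s : Finset ℕ) : s.image (rankIn s) = Finset.Icc 1 s.card := by
  refine Finset.eq_of_subset_of_card_le (fun x hx => ?_) ?_
  · obtain ⟨a, ha, rfl⟩ := Finset.mem_image.1 hx
    refine Finset.mem_Icc.2 ⟨Finset.card_pos.2 ⟨a, by simp [ha]⟩, Finset.card_filter_le _ _⟩
  · rw [Finset.card_image_of_injOn]
    · simp
    · intro a ha b hb h
      rcases lt_trichotomy a b with h' | h' | h'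
      · exact absurd h (rankIn_strictMonoOn s hb h').ne
      · exact h'
      · exact absurd h (rankIn_strictMonoOn s ha h').ne'

theorem toFinset_map (g : ℕ → ℕ) (w : List ℕ) : (w.map g).toFinset = w.toFinset.image g := by
  ext; simp

theorem toFinset_pack (w : List ℕ) : (pack w).toFinset = Finset.Icc 1 w.toFinset.card := by
  rw [pack, toFinset_map, image_rankIn]

theorem isPacked_pack (w : List ℕ) : IsPacked (pack w) := ⟨_, toFinset_pack w⟩

@[simp] theorem length_pack (w : List ℕ) : (pack w).length = w.length := by simp [pack]

theorem pack_eq_self {w : List ℕ} (h : IsPacked w) : pack w = w := by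
  obtain ⟨k, hk⟩ := h
  rw [pack, hk]
  conv_rhs => rw [← List.map_id w]
  refine List.map_congr_left fun a ha => ?_
  have ha' : a ∈ Finset.Icc 1 k := by rw [← hk]; simpa using ha
  rw [Finset.mem_Icc] at ha'
  have : (Finset.Icc 1 k).filter (· ≤ a) = Finset.Icc 1 a := by
    ext x; simp only [Finset.mem_filter, Finset.mem_Icc]; omega
  simp [rankIn, this]

theorem pack_map {g : ℕ → ℕ} {w : List ℕ} (hg : ∀ a ∈ w, ∀ b ∈ w, a < b → g a < g b) :
    pack (w.map g) = pack w := by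
  rw [pack, pack, toFinset_map, List.map_map]
  refine List.map_congr_left fun a ha => ?_
  have hle : ∀ x ∈ w, (g x ≤ g a ↔ x ≤ a) := fun x hx => by
    constructor
    · intro h
      by_contra h'
      exact absurd (hg a ha x hx (not_le.1 h')) (not_lt.2 h)
    · intro h
      rcases h.lt_or_eq with h | rfl
      · exact (hg x hx a ha h).le
      · exact le_rfl
  have : (w.toFinset.image g).filter (· ≤ g a) = (w.toFinset.filter (· ≤ a)).image g := by
    ext y
    simp only [Finset.mem_filter, Finset.mem_image, List.mem_toFinset]
    constructor
    · rintro ⟨⟨x, hx, rfl⟩, h⟩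
      exact ⟨x, ⟨hx, (hle x hx).1 h⟩, rfl⟩
    · rintro ⟨x, ⟨hx, h⟩, rfl⟩
      exact ⟨⟨x, hx, rfl⟩, (hle x hx).2 h⟩
  simp only [rankIn, Function.comp_apply, this]
  refine Finset.card_image_of_injOn fun x hx y hy h => ?_
  simp only [Finset.coe_filter, List.mem_toFinset, Set.mem_ofPred_eq] at hx hy
  rcases lt_trichotomy x y with h' | h' | h'
  · exact absurd h (hg x hx.1 y hy.1 h').ne
  · exact h'
  · exact absurd h (hg y hy.1 x hx.1 h').ne'

theorem pack_map_rankIn {s : Finset ℕ} {w : List ℕ} (h : ∀ a ∈ w, a ∈ s) :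
    pack (w.map (rankIn s)) = pack w :=
  pack_map fun _ _ b hb => rankIn_strictMonoOn s (h b hb)

theorem pack_take_pack (k : ℕ) (w : List ℕ) : pack ((pack w).take k) = pack (w.take k) := by
  rw [pack.eq_def w, ← List.map_take]
  exact pack_map_rankIn fun a ha => by simpa using List.mem_of_mem_take ha

theorem pack_drop_pack (k : ℕ) (w : List ℕ) : pack ((pack w).drop k) = pack (w.drop k) := by
  rw [pack.eq_def w, ← List.map_drop]
  exact pack_map_rankIn fun a ha => by simpa using List.mem_of_mem_drop ha

theorem maxLetter_pack (w : List ℕ) : maxLetter (pack w) = w.toFinset.card := by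
  rw [maxLetter, toFinset_pack]
  apply le_antisymm
  · exact Finset.sup_le fun x hx => (Finset.mem_Icc.1 hx).2
  · rcases Nat.eq_zero_or_pos w.toFinset.card with h | h
    · omega
    · exact Finset.le_sup (f := id) (Finset.mem_Icc.2 ⟨h, le_rfl⟩)

theorem le_maxLetter {w : List ℕ} {a : ℕ} (h : a ∈ w) : a ≤ maxLetter w :=
  Finset.le_sup (f := id) (by simpa using h)

theorem one_le_of_isPacked {w : List ℕ} (h : IsPacked w) {a : ℕ} (ha : a ∈ w) : 1 ≤ a := by
  obtain ⟨k, hk⟩ := h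
  have : a ∈ Finset.Icc 1 k := by rw [← hk]; simpa using ha
  exact (Finset.mem_Icc.1 this).1

theorem map_pack_shuffle {u v : List ℕ} {m : ℕ} (hu : ∀ a ∈ u, a ≤ m) (hv : ∀ b ∈ v, 1 ≤ b) :
    (shuffle u (v.map (· + m))).map pack =
      shuffle (pack u) ((pack v).map (· + maxLetter (pack u))) := by
  set s := u.toFinset ∪ v.toFinset.image (· + m) with hs
  have h1 : (shuffle u (v.map (· + m))).map pack =
      (shuffle u (v.map (· + m))).map (List.map (rankIn s)) := by
    refine Multiset.map_congr rfl fun w hw => ?_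
    have : w.toFinset = s := by
      rw [List.toFinset_eq_of_perm _ _ (perm_of_mem_shuffle hw), List.toFinset_append, toFinset_map]
    rw [pack, this]
  have h2 : u.map (rankIn s) = pack u := by
    refine List.map_congr_left fun a ha => ?_
    have := hu a ha
    rw [rankIn, rankIn, hs, Finset.filter_union]
    congr 1
    rw [Finset.union_eq_left]
    intro x hx
    simp only [Finset.mem_filter, Finset.mem_image, List.mem_toFinset] at hx
    obtain ⟨⟨b, hb, rfl⟩, hx⟩ := hx
    have := hv b hb
    omega
  have h3 : (v.map (· + m)).map (rankIn s) = (pack v).map (· + maxLetter (pack u)) := by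
    rw [maxLetter_pack, pack, List.map_map, List.map_map]
    refine List.map_congr_left fun b hb => ?_
    have := hv b hb
    simp only [Function.comp_apply, rankIn, hs, Finset.filter_union]
    rw [Finset.card_union_of_disjoint, add_comm]
    · congr 1
      · rw [Finset.filter_image, Finset.card_image_of_injective _ (add_left_injective m)]
        simp
      · rw [Finset.filter_true_of_mem]
        intro x hx
        have := hu x (by simpa using hx)
        omega
    · rw [Finset.disjoint_left]
      intro x hx hx'
      simp only [Finset.mem_filter, Finset.mem_image, List.mem_toFinset] at hx hx'
      obtain ⟨⟨c, hc, rfl⟩, _⟩ := hx'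
      have := hu _ hx.1
      have := hv c hc
      omega
  rw [h1, ← shuffle_map, h2, h3]

end WordLemmas

/-- Packed words, i.e. the elements of the disjoint union of the sets `Surj_n`: the word
`σ(1) … σ(n)` represents the surjection `σ : {1, …, n} → {1, …, k}`. -/
@[ext]
structure PackedWord where
  val : List ℕ
  isPacked : IsPacked val

namespace PackedWord

open WordLemmas

theorem val_injective : Function.Injective PackedWord.val := fun _ _ h => PackedWord.ext h

/-- The length of a packed word. -/
def length (σ : PackedWord) : ℕ := σ.val.length

/-- The packing of a word as a packed word. -/
def ofWord (w : List ℕ) : PackedWord := ⟨pack w, isPacked_pack w⟩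

theorem isPacked_of_mem_shuffle {σ τ : PackedWord} {w : List ℕ}
    (h : w ∈ shuffle σ.val (τ.val.map (· + maxLetter σ.val))) : IsPacked w := by
  have h' := List.toFinset_eq_of_perm _ _ (perm_of_mem_shuffle h)
  obtain ⟨⟨k, hk⟩, ⟨l, hl⟩⟩ := And.intro σ.isPacked τ.isPacked
  have hm : maxLetter σ.val = k := by
    conv_lhs => rw [← pack_eq_self σ.isPacked, maxLetter_pack, hk]
    simp
  refine ⟨k + l, ?_⟩
  rw [h', List.toFinset_append, toFinset_map, hk, hl, hm]
  ext x
  simp only [Finset.mem_union, Finset.mem_image, Finset.mem_Icc]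
  constructor
  · rintro (h | ⟨y, h, rfl⟩) <;> omega
  · intro h
    by_cases hx : x ≤ k
    · exact Or.inl ⟨h.1, hx⟩
    · exact Or.inr ⟨x - k, by omega, by omega⟩

/-- The terms of the product `σ . τ`: all the shufflings of the word `σ` and of the word `τ` whose
letters have been shifted by the maximum of `σ`. -/
def mul (σ τ : PackedWord) : Multiset PackedWord :=
  (shuffle σ.val (τ.val.map (· + maxLetter σ.val))).pmap PackedWord.mk fun _ h => isPacked_of_mem_shuffle h

/-- The terms of the coproduct of `σ`: cut the word `σ` between the `k`-th and the `(k+1)`-th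
letter, `0 ≤ k ≤ n`, and pack the two words so obtained. -/
def comul (σ : PackedWord) : Multiset (PackedWord × PackedWord) :=
  (Multiset.range (σ.length + 1)).map fun k => (ofWord (σ.val.take k), ofWord (σ.val.drop k))

/-- The empty packed word. -/
def one : PackedWord := ⟨[], 0, rfl⟩

theorem mul_val (σ τ : PackedWord) :
    (mul σ τ).map PackedWord.val = shuffle σ.val (τ.val.map (· + maxLetter σ.val)) := by
  rw [mul, Multiset.map_pmap]
  simp [Multiset.pmap_eq_map]

theorem mul_eq (σ τ : PackedWord) :
    mul σ τ = (shuffle σ.val (τ.val.map (· + maxLetter σ.val))).map ofWord := by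
  apply Multiset.map_injective val_injective
  rw [mul_val, Multiset.map_map]
  conv_lhs => rw [← Multiset.map_id (shuffle _ _)]
  exact Multiset.map_congr rfl fun w hw => (pack_eq_self (isPacked_of_mem_shuffle hw)).symm

theorem comul_eq (σ : PackedWord) :
    comul σ = (splits σ.val).map fun p => (ofWord p.1, ofWord p.2) := by
  rw [comul, splits, Multiset.map_map]
  rfl

theorem ofWord_val (σ : PackedWord) : ofWord σ.val = σ := PackedWord.ext (pack_eq_self σ.isPacked)

theorem comul_ofWord (w : List ℕ) :
    comul (ofWord w) = (splits w).map fun p => (ofWord p.1, ofWord p.2) := by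
  rw [comul, splits, Multiset.map_map, length]
  simp only [ofWord, length_pack, Function.comp_def, pack_take_pack, pack_drop_pack]

theorem mul_ofWord {u v : List ℕ} {m : ℕ} (hu : ∀ a ∈ u, a ≤ m) (hv : ∀ b ∈ v, 1 ≤ b) :
    (shuffle u (v.map (· + m))).map ofWord = mul (ofWord u) (ofWord v) := by
  apply Multiset.map_injective val_injective
  rw [mul_val, Multiset.map_map]
  exact map_pack_shuffle hu hv

theorem maxLetter_mul {σ τ : PackedWord} {w : List ℕ}
    (h : w ∈ shuffle σ.val (τ.val.map (· + maxLetter σ.val))) :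
    maxLetter w = maxLetter τ.val + maxLetter σ.val := by
  have h' := List.toFinset_eq_of_perm _ _ (perm_of_mem_shuffle h)
  rw [maxLetter, h', List.toFinset_append, Finset.sup_union, toFinset_map]
  obtain ⟨l, hl⟩ := τ.isPacked
  apply le_antisymm
  · refine sup_le (le_add_left le_rfl) (Finset.sup_le fun x hx => ?_)
    obtain ⟨y, hy, rfl⟩ := Finset.mem_image.1 hx
    exact Nat.add_le_add_right (le_maxLetter (by simpa using hy)) _
  · by_cases h0 : τ.val = []
    · simp [h0, maxLetter]
    · refine le_trans ?_ le_sup_right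
      obtain ⟨y, hy, hy'⟩ := Finset.exists_mem_eq_sup τ.val.toFinset (by simpa using h0) id
      rw [maxLetter.eq_def τ.val, hy']
      exact Finset.le_sup (f := id) (Finset.mem_image_of_mem _ hy)

instance : HopfBasis PackedWord where
  one := one
  mul := mul
  comul := comul
  deg := length
  one_mul σ := by
    apply Multiset.map_injective val_injective
    rw [mul_val]
    simp [one, maxLetter]
  mul_one σ := by
    apply Multiset.map_injective val_injective
    rw [mul_val]
    simp [one]
  mul_assoc σ τ ρ := by
    apply Multiset.map_injective val_injective
    rw [Multiset.map_bind, Multiset.map_bind]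
    simp only [mul_val]
    have h1 := Multiset.bind_map (mul σ τ)
      (fun w => shuffle w (ρ.val.map (· + maxLetter w))) PackedWord.val
    have h2 := Multiset.bind_map (mul τ ρ)
      (fun w => shuffle σ.val (w.map (· + maxLetter σ.val))) PackedWord.val
    rw [mul_val] at h1 h2
    refine h1.symm.trans (Eq.trans ?_ h2)
    have h3 := Multiset.bind_map (shuffle τ.val (ρ.val.map (· + maxLetter τ.val)))
      (fun w => shuffle σ.val w) (List.map (· + maxLetter σ.val))
    rw [← shuffle_map] at h3
    rw [← h3, ← shuffle_assoc]
    refine Multiset.bind_congr fun w hw => ?_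
    rw [maxLetter_mul hw, List.map_map]
    congr 1
    exact List.map_congr_left fun a _ => (add_assoc _ _ _).symm
  comul_one := by
    rw [comul_eq]
    simp only [one, splits_nil, Multiset.map_singleton]
    rfl
  comul_mul σ τ := by
    rw [mul_eq, Multiset.bind_map]
    simp only [comul_ofWord]
    rw [← Multiset.map_bind, splits_shuffle, splits_map, comul_eq, comul_eq, Multiset.bind_map,
      Multiset.map_bind]
    refine Multiset.bind_congr fun p hp => ?_
    rw [Multiset.bind_map, Multiset.bind_map, Multiset.map_bind]
    refine Multiset.bind_congr fun q hq => ?_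
    have hp' := append_of_mem_splits hp
    have hq' := append_of_mem_splits hq
    have hσ : ∀ a ∈ p.1 ++ p.2, a ≤ maxLetter σ.val := fun a ha => le_maxLetter (hp' ▸ ha)
    have hτ : ∀ a ∈ q.1 ++ q.2, 1 ≤ a := fun a ha => one_le_of_isPacked τ.isPacked (hq' ▸ ha)
    simp only
    rw [← mul_ofWord (fun a ha => hσ a (List.mem_append_left _ ha))
        (fun a ha => hτ a (List.mem_append_left _ ha)),
      ← mul_ofWord (fun a ha => hσ a (List.mem_append_right _ ha))
        (fun a ha => hτ a (List.mem_append_right _ ha)), Multiset.map_bind, Multiset.bind_map]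
    simp [Multiset.map_map]
  coassoc σ := by
    have h := congrArg (Multiset.map fun t : List ℕ × List ℕ × List ℕ =>
      (ofWord t.1, ofWord t.2.1, ofWord t.2.2)) (splits_coassoc σ.val)
    rw [Multiset.map_bind, Multiset.map_bind] at h
    rw [comul_eq, Multiset.bind_map, Multiset.bind_map]
    simp only [comul_ofWord]
    simpa only [Multiset.map_map, Function.comp_def] using h
  filter_left σ := by
    rw [comul_eq, Multiset.filter_map]
    simp only [Function.comp_def, length, ofWord, length_pack]
    rw [filter_splits_left, Multiset.map_singleton, ← ofWord, ← ofWord, ofWord_val]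
    rfl
  filter_right σ := by
    rw [comul_eq, Multiset.filter_map]
    simp only [Function.comp_def, length, ofWord, length_pack]
    rw [filter_splits_right, Multiset.map_singleton, ← ofWord, ← ofWord, ofWord_val]
    rfl
  deg_eq_zero σ := by
    rw [length, List.length_eq_zero_iff]
    exact ⟨fun h => PackedWord.ext h, fun h => by rw [h]; rfl⟩
  deg_mul σ τ x hx := by
    have h : x.1 ∈ (mul σ τ).map PackedWord.val := Multiset.mem_map_of_mem _ hx
    rw [mul_val] at h
    simpa [length] using (perm_of_mem_shuffle h).length_eq
  deg_comul σ p hp := by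
    rw [comul_eq] at hp
    obtain ⟨q, hq, rfl⟩ := Multiset.mem_map.1 hp
    simp [length, ofWord, ← append_of_mem_splits hq]

end PackedWord

/-- A rooted forest with vertex set `V`, together with a total preorder on `V`. The forest is given
by its edges, oriented towards the roots: `edge v w` means that there is an edge from `v` down to
`w`, i.e. `w` is the parent of `v`. Each vertex has at most one parent (the roots are the vertices
which have none) and there are no cycles. -/
@[ext]
structure PreorderedForest (V : Type) where
  edge : V → V → Prop
  edge_unique : ∀ v w w', edge v w → edge v w' → w = w'
  acyclic : ∀ v, ¬ Relation.TransGen edge v v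
  le : V → V → Prop
  le_trans : ∀ u v w, le u v → le v w → le u w
  le_total : ∀ v w, le v w ∨ le w v

/-- The multiset of all the elements of a finite type which satisfy a predicate, each of them
occurring once. -/
noncomputable def enum {α : Type*} [Finite α] (P : α → Prop) : Multiset α :=
  (Set.toFinite {x | P x}).toFinset.val

namespace ForestLemmas

@[simp] theorem mem_enum {α : Type*} [Finite α] {P : α → Prop} {x : α} : x ∈ enum P ↔ P x := by
  simp [enum]

theorem nodup_enum {α : Type*} [Finite α] (P : α → Prop) : (enum P).Nodup :=
  (Set.toFinite {x | P x}).toFinset.nodup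

theorem enum_eq_singleton {α : Type*} [Finite α] {P : α → Prop} {a : α} (h : ∀ x, P x ↔ x = a) :
    enum P = {a} :=
  (Multiset.Nodup.ext (nodup_enum P) (Multiset.nodup_singleton a)).2 fun x => by simp [h]

theorem filter_enum {α : Type*} [Finite α] (P Q : α → Prop) [DecidablePred Q] :
    (enum P).filter Q = enum fun x => P x ∧ Q x :=
  (Multiset.Nodup.ext ((nodup_enum P).filter _) (nodup_enum _)).2 fun x => by simp

theorem enum_map_congr {α β γ : Type*} [Finite α] [Finite β] {P : α → Prop} {Q : β → Prop}
    {f : α → γ} {g : β → γ} (i : α → β) (j : β → α) (hi : ∀ a, P a → Q (i a))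
    (hj : ∀ b, Q b → P (j b)) (hij : ∀ a, P a → j (i a) = a) (hji : ∀ b, Q b → i (j b) = b)
    (h : ∀ a, P a → f a = g (i a)) : (enum P).map f = (enum Q).map g := by
  refine Multiset.map_eq_map_of_bij_of_nodup f g (nodup_enum P) (nodup_enum Q) (fun a _ => i a)
    (fun a ha => mem_enum.2 (hi a (mem_enum.1 ha))) (fun a ha b hb hab => ?_)
    (fun b hb => ⟨j b, mem_enum.2 (hj b (mem_enum.1 hb)), hji b (mem_enum.1 hb)⟩)
    (fun a ha => h a (mem_enum.1 ha))
  rw [← hij a (mem_enum.1 ha), hab, hij b (mem_enum.1 hb)]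

theorem enum_bind {α β γ : Type*} [Finite α] [Finite β] (P : α → Prop) (Q : α → β → Prop)
    (f : α → β → γ) : ((enum P).bind fun a => (enum (Q a)).map (f a)) =
      (enum fun x : α × β => P x.1 ∧ Q x.1 x.2).map fun x => f x.1 x.2 := by
  have h : ((enum P).bind fun a => (enum (Q a)).map (Prod.mk a)) =
      enum fun x : α × β => P x.1 ∧ Q x.1 x.2 := by
    refine (Multiset.Nodup.ext ?_ (nodup_enum _)).2 fun x => ?_
    · refine Multiset.nodup_bind.2 ⟨fun a _ => (nodup_enum _).map (Prod.mk_right_injective a), ?_⟩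
      refine (nodup_enum P).pairwise fun a _ b _ hab => ?_
      refine Multiset.disjoint_left.2 fun {x} hx hx' => hab ?_
      obtain ⟨_, _, rfl⟩ := Multiset.mem_map.1 hx
      obtain ⟨_, _, h⟩ := Multiset.mem_map.1 hx'
      exact (congrArg Prod.fst h).symm
    · obtain ⟨a, b⟩ := x
      simp
  rw [← h, Multiset.map_bind]
  simp [Multiset.map_map]

end ForestLemmas

namespace PreorderedForest

open ForestLemmas

variable {V W X : Type}

/-- There is an oriented path (possibly of length `0`) from `v` down to `w`. -/
def Reaches (F : PreorderedForest V) (v w : V) : Prop := Relation.ReflTransGen F.edge v w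

/-- The structure induced along an injective map of vertex sets. -/
def comap (F : PreorderedForest V) (f : W → V) (hf : Function.Injective f) :
    PreorderedForest W where
  edge v w := F.edge (f v) (f w)
  edge_unique _ _ _ h h' := hf (F.edge_unique _ _ _ h h')
  acyclic v h := F.acyclic (f v) (h.lift f fun _ _ h => h)
  le v w := F.le (f v) (f w)
  le_trans _ _ _ h h' := F.le_trans _ _ _ h h'
  le_total _ _ := F.le_total _ _

/-- The subforest whose vertices are the elements of `S`, with all the edges of `F` between these
vertices, and with the restriction of the total preorder. -/
def restrict (F : PreorderedForest V) (S : Set V) : PreorderedForest S :=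
  F.comap Subtype.val Subtype.val_injective

/-- The preordered forest `FG`: the disjoint union of `F` and `G`, with the initial preorders on the
vertices of `F` and of `G`, the vertices of `F` being smaller than the vertices of `G`. -/
def concat (F : PreorderedForest V) (G : PreorderedForest W) : PreorderedForest (V ⊕ W) where
  edge := Sum.LiftRel F.edge G.edge
  edge_unique := by
    rintro _ _ _ (h | h) h'
    · cases h' with
      | inl h' => rw [F.edge_unique _ _ _ h h']
    · cases h' with
      | inr h' => rw [G.edge_unique _ _ _ h h']
  acyclic := by
    have h1 : ∀ x y, Relation.TransGen (Sum.LiftRel F.edge G.edge) x y →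
        Sum.LiftRel (Relation.TransGen F.edge) (Relation.TransGen G.edge) x y := by
      intro x y h
      induction h with
      | single h =>
        cases h with
        | inl h => exact .inl (.single h)
        | inr h => exact .inr (.single h)
      | tail _ h ih =>
        cases h with
        | inl h => cases ih with
          | inl ih => exact .inl (ih.tail h)
        | inr h => cases ih with
          | inr ih => exact .inr (ih.tail h)
    intro v h
    rcases h1 v v h with h | h
    · exact F.acyclic _ h
    · exact G.acyclic _ h
  le := Sum.Lex F.le G.le
  le_trans := by
    rintro (u | u) (v | v) (w | w) h h' <;> simp_all
    · exact F.le_trans _ _ _ h h'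
    · exact G.le_trans _ _ _ h h'
  le_total := by
    rintro (v | v) (w | w) <;> simp
    · exact F.le_total v w
    · exact G.le_total v w

/-- The preordered forest with no vertices. -/
def empty : PreorderedForest Empty where
  edge _ _ := False
  edge_unique v := v.elim
  acyclic v := v.elim
  le _ _ := True
  le_trans u := u.elim
  le_total v := v.elim

/-- An admissible cut of `F`: a set of vertices such that there is no oriented path between two
different elements. -/
def IsAdmissibleCut (F : PreorderedForest V) (c : Set V) : Prop :=
  ∀ v ∈ c, ∀ w ∈ c, v ≠ w → ¬ F.Reaches v w

/-- The vertices of `Lea_c(F)`: those which are above the cut `c`. -/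
def lea (F : PreorderedForest V) (c : Set V) : Set V := {w | ∃ v ∈ c, F.Reaches w v}

/-- The vertices of `Roo_c(F)`: all the other vertices. -/
def roo (F : PreorderedForest V) (c : Set V) : Set V := (F.lea c)ᶜ

end PreorderedForest

/-- Two preordered forests are isomorphic if there is a bijection between their vertices which
preserves the edges and the preorder in both directions. Here the vertex sets are `{0, …, n-1}`. -/
def forestSetoid : Setoid (Σ n, PreorderedForest (Fin n)) where
  r F G := ∃ e : Fin F.1 ≃ Fin G.1, F.2 = G.2.comap e e.injective
  iseqv :=
    { refl := fun F => ⟨Equiv.refl _, rfl⟩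
      symm := by
        rintro ⟨n, F⟩ ⟨m, G⟩ ⟨(e : Fin n ≃ Fin m), (h : F = G.comap e e.injective)⟩
        subst h
        exact ⟨e.symm, by simp [PreorderedForest.comap]⟩
      trans := by
        rintro ⟨n, F⟩ ⟨m, G⟩ ⟨k, H⟩ ⟨(e : Fin n ≃ Fin m), (h : F = G.comap e e.injective)⟩
          ⟨(e' : Fin m ≃ Fin k), (h' : G = H.comap e' e'.injective)⟩
        subst h'
        subst h
        exact ⟨e.trans e', rfl⟩ }

/-- The set of (isomorphism classes of) finite preordered forests. -/
def POForest : Type := Quotient forestSetoid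

namespace PreorderedForest

open ForestLemmas

variable {V W X : Type}

/-- `T ⊆ S` contains every vertex of `S` which is above an element of `T`. -/
def RelClosed (F : PreorderedForest V) (S T : Set V) : Prop :=
  T ⊆ S ∧ ∀ v ∈ S, ∀ w ∈ T, F.edge v w → v ∈ T

theorem RelClosed.mem_of_reaches {F : PreorderedForest V} {T : Set V}
    (h : F.RelClosed Set.univ T) {v w : V} (hw : w ∈ T) (hvw : F.Reaches v w) : v ∈ T := by
  induction hvw using Relation.ReflTransGen.head_induction_on with
  | refl => exact hw
  | head h' _ ih => exact h.2 _ trivial _ ih h'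

theorem not_edge_of_reaches (F : PreorderedForest V) {v w : V} (h : F.edge v w) :
    ¬ F.Reaches w v := fun h' => F.acyclic v (Relation.TransGen.head' h h')

variable [Finite V] [Finite W] [Finite X]

/-- The isomorphism class of a preordered forest. -/
noncomputable def cls (F : PreorderedForest V) : POForest :=
  Quotient.mk forestSetoid
    ⟨Nat.card V, F.comap (Finite.equivFin V).symm (Finite.equivFin V).symm.injective⟩

theorem cls_comap_equiv (F : PreorderedForest V) (e : W ≃ V) :
    (F.comap e e.injective).cls = F.cls := by
  refine Quotient.sound (s := forestSetoid)
    ⟨(Finite.equivFin W).symm.trans (e.trans (Finite.equivFin V)), ?_⟩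
  simp [comap]

theorem cls_comap_congr {U : Type} (F : PreorderedForest U) {f : W → U} {g : X → U}
    (hf : Function.Injective f) (hg : Function.Injective g) (h : Set.range f = Set.range g) :
    (F.comap f hf).cls = (F.comap g hg).cls := by
  let e : W ≃ X := (Equiv.ofInjective f hf).trans
    ((Equiv.setCongr h).trans (Equiv.ofInjective g hg).symm)
  have he : ∀ w, g (e w) = f w := fun w => by
    simp [e, Equiv.apply_ofInjective_symm]
  rw [← cls_comap_equiv (F.comap g hg) e]
  simp [comap, he]

theorem cls_fin {n : ℕ} (F : PreorderedForest (Fin n)) :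
    F.cls = Quotient.mk forestSetoid ⟨n, F⟩ :=
  Quotient.sound (s := forestSetoid) ⟨(Finite.equivFin (Fin n)).symm, rfl⟩

theorem exists_cls (x : POForest) : ∃ n, ∃ F : PreorderedForest (Fin n), F.cls = x := by
  induction x using Quotient.inductionOn with
  | h a => exact ⟨a.1, a.2, cls_fin a.2⟩

theorem cls_of_isEmpty [IsEmpty V] (F : PreorderedForest V) : F.cls = empty.cls := by
  rw [← cls_comap_equiv F (Equiv.equivOfIsEmpty Empty V)]
  congr 1
  ext v
  · exact v.elim
  · exact v.elim

theorem cls_concat_congr {V' W' : Type} [Finite V'] [Finite W'] (F : PreorderedForest V)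
    (G : PreorderedForest W) (e : V' ≃ V) (e' : W' ≃ W) :
    ((F.comap e e.injective).concat (G.comap e' e'.injective)).cls = (F.concat G).cls := by
  rw [← cls_comap_equiv (F.concat G) (Equiv.sumCongr e e')]
  congr 1
  ext v w <;> rcases v with v | v <;> rcases w with w | w <;> simp [concat, comap]

/-- The isomorphism class of the subforest of `F` with vertex set `S`. -/
noncomputable def clsOn (F : PreorderedForest V) (S : Set V) : POForest := (F.restrict S).cls

/-- The terms of the coproduct of a preordered forest: the pairs `(Lea_c(F), Roo_c(F))`, where `c`
runs over the admissible cuts of `F`. -/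
noncomputable def cutTerms (F : PreorderedForest V) : Multiset (POForest × POForest) :=
  (enum F.IsAdmissibleCut).map fun c => (F.clsOn (F.lea c), F.clsOn (F.roo c))

theorem clsOn_empty (F : PreorderedForest V) : F.clsOn ∅ = empty.cls := cls_of_isEmpty _

theorem clsOn_univ (F : PreorderedForest V) : F.clsOn Set.univ = F.cls :=
  F.cls_comap_congr (g := id) Subtype.val_injective Function.injective_id (by simp)

theorem exists_reaches (F : PreorderedForest V) {T : Set V} {v : V} (hv : v ∈ T) :
    ∃ w ∈ T, F.Reaches v w ∧ ∀ x ∈ T, ¬ F.edge w x := by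
  have : IsTrans V (fun x y => Relation.TransGen F.edge y x) := ⟨fun _ _ _ h h' => h'.trans h⟩
  have : Std.Irrefl (fun x y => Relation.TransGen F.edge y x) := ⟨F.acyclic⟩
  have wf := Finite.wellFounded_of_trans_of_irrefl (fun x y => Relation.TransGen F.edge y x)
  induction v using wf.induction with
  | h v ih =>
    by_cases h : ∃ x ∈ T, F.edge v x
    · obtain ⟨x, hx, hvx⟩ := h
      obtain ⟨w, hw, hxw, hw'⟩ := ih x (.single hvx) hx
      exact ⟨w, hw, .head hvx hxw, hw'⟩
    · push Not at h
      exact ⟨v, hv, .refl, h⟩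

theorem cutTerms_eq_closed (F : PreorderedForest V) :
    F.cutTerms = (enum (F.RelClosed Set.univ)).map fun T =>
      (F.clsOn T, F.clsOn (Set.univ \ T)) := by
  refine enum_map_congr F.lea (fun T => {v | v ∈ T ∧ ∀ x ∈ T, ¬ F.edge v x}) ?_ ?_ ?_ ?_ ?_
  · rintro c -
    exact ⟨Set.subset_univ _, fun v _ w ⟨x, hx, hwx⟩ hvw => ⟨x, hx, .head hvw hwx⟩⟩
  · rintro T hT v ⟨hv, hv'⟩ w ⟨hw, hw'⟩ hne hvw
    rcases Relation.ReflTransGen.cases_head hvw with rfl | ⟨x, hvx, hxw⟩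
    · exact hne rfl
    · exact hv' x (hT.mem_of_reaches hw hxw) hvx
  · intro c hc
    ext v
    constructor
    · rintro ⟨⟨x, hx, hvx⟩, hv⟩
      rcases Relation.ReflTransGen.cases_head hvx with rfl | ⟨y, hvy, hyx⟩
      · exact hx
      · exact absurd hvy (hv y ⟨x, hx, hyx⟩)
    · intro hv
      refine ⟨⟨v, hv, .refl⟩, ?_⟩
      rintro x ⟨y, hy, hxy⟩ hvx
      by_cases h : v = y
      · subst h
        exact F.not_edge_of_reaches hvx hxy
      · exact hc v hv y hy h (.head hvx hxy)
  · intro T hT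
    ext v
    constructor
    · rintro ⟨w, ⟨hw, -⟩, hvw⟩
      exact hT.mem_of_reaches hw hvw
    · intro hv
      obtain ⟨w, hw, hvw, hw'⟩ := F.exists_reaches hv
      exact ⟨w, ⟨hw, hw'⟩, hvw⟩
  · intro c _
    rw [← Set.compl_eq_univ_sdiff]
    rfl

theorem cutTerms_comap (F : PreorderedForest V) (f : W → V) (hf : Function.Injective f) :
    (F.comap f hf).cutTerms = (enum (F.RelClosed (Set.range f))).map fun T =>
      (F.clsOn T, F.clsOn (Set.range f \ T)) := by
  rw [cutTerms_eq_closed]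
  refine enum_map_congr (fun T => f '' T) (fun T => f ⁻¹' T) ?_ ?_ ?_ ?_ ?_
  · rintro T ⟨-, hT⟩
    refine ⟨Set.image_subset_range f T, ?_⟩
    rintro _ ⟨v, rfl⟩ _ ⟨w, hw, rfl⟩ h
    exact ⟨v, hT v trivial w hw h, rfl⟩
  · rintro T ⟨-, hT⟩
    exact ⟨Set.subset_univ _, fun v _ w hw h => hT (f v) ⟨v, rfl⟩ (f w) hw h⟩
  · intro T _
    exact Set.preimage_image_eq T hf
  · intro T hT
    exact Set.image_preimage_eq_of_subset hT.1
  · intro T _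
    refine Prod.ext ?_ ?_
    · refine F.cls_comap_congr (hf.comp Subtype.val_injective) Subtype.val_injective ?_
      rw [Set.range_comp, Subtype.range_coe, Subtype.range_coe]
    · refine F.cls_comap_congr (hf.comp Subtype.val_injective) Subtype.val_injective ?_
      rw [Set.range_comp, Subtype.range_coe, Subtype.range_coe, Set.image_sdiff hf,
        Set.image_univ]

theorem cutTerms_restrict (F : PreorderedForest V) (S : Set V) :
    (F.restrict S).cutTerms = (enum (F.RelClosed S)).map fun T =>
      (F.clsOn T, F.clsOn (S \ T)) := by
  rw [restrict, cutTerms_comap, Subtype.range_coe]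

theorem cutTerms_comap_equiv (F : PreorderedForest V) (e : W ≃ V) :
    (F.comap e e.injective).cutTerms = F.cutTerms := by
  rw [cutTerms_comap, cutTerms_eq_closed, e.range_eq_univ]

end PreorderedForest

namespace POForest

open PreorderedForest ForestLemmas

variable {V W X : Type} [Finite V] [Finite W] [Finite X]

/-- The number of vertices. -/
def deg : POForest → ℕ := Quotient.lift (fun a => a.1) fun a b ⟨e, _⟩ => by
  simpa using Nat.card_congr e

/-- The product `FG` of (classes of) preordered forests. -/
noncomputable def mul : POForest → POForest → POForest :=
  Quotient.lift₂ (fun a b => (a.2.concat b.2).cls) fun a b a' b' ⟨e, h⟩ ⟨e', h'⟩ => by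
    rw [h, h', cls_concat_congr]

/-- The terms `Lea_c(F) ⊗ Roo_c(F)` of the coproduct of (the class of) a preordered forest. -/
noncomputable def comul : POForest → Multiset (POForest × POForest) :=
  Quotient.lift (fun a => a.2.cutTerms) fun a b ⟨e, h⟩ => by
    rw [h, cutTerms_comap_equiv]

theorem deg_cls (F : PreorderedForest V) : deg F.cls = Nat.card V := rfl

theorem mul_cls (F : PreorderedForest V) (G : PreorderedForest W) :
    mul F.cls G.cls = (F.concat G).cls := cls_concat_congr _ _ _ _

theorem comul_cls (F : PreorderedForest V) : comul F.cls = F.cutTerms :=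
  cutTerms_comap_equiv _ _

theorem comul_clsOn (F : PreorderedForest V) (S : Set V) :
    comul (F.clsOn S) = (enum (F.RelClosed S)).map fun T => (F.clsOn T, F.clsOn (S \ T)) := by
  rw [clsOn, comul_cls, cutTerms_restrict]

theorem mul_assoc (x y z : POForest) : mul (mul x y) z = mul x (mul y z) := by
  obtain ⟨_, F, rfl⟩ := exists_cls x
  obtain ⟨_, G, rfl⟩ := exists_cls y
  obtain ⟨_, H, rfl⟩ := exists_cls z
  rw [mul_cls, mul_cls, mul_cls, mul_cls,
    ← cls_comap_equiv (F.concat (G.concat H)) (Equiv.sumAssoc _ _ _)]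
  congr 1
  ext v w <;> rcases v with (v | v) | v <;> rcases w with (w | w) | w <;> simp [concat, comap]

theorem one_mul (x : POForest) : mul empty.cls x = x := by
  obtain ⟨_, F, rfl⟩ := exists_cls x
  rw [mul_cls, ← cls_comap_equiv (empty.concat F) (Equiv.emptySum Empty _).symm]
  congr 1
  ext v w <;> simp [concat, comap]

theorem mul_one (x : POForest) : mul x empty.cls = x := by
  obtain ⟨_, F, rfl⟩ := exists_cls x
  rw [mul_cls, ← cls_comap_equiv (F.concat empty) (Equiv.sumEmpty _ Empty).symm]
  congr 1
  ext v w <;> simp [concat, comap]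

theorem coassoc (x : POForest) :
    ((comul x).bind fun p => (comul p.1).map fun q => (q.1, q.2, p.2)) =
      (comul x).bind fun p => (comul p.2).map fun q => (p.1, q.1, q.2) := by
  obtain ⟨n, F, rfl⟩ := exists_cls x
  rw [comul_cls, cutTerms_eq_closed, Multiset.bind_map, Multiset.bind_map]
  simp only [comul_clsOn, Multiset.map_map, Function.comp_def]
  rw [enum_bind (F.RelClosed Set.univ) (fun U T => F.RelClosed U T)
      (fun U T => (F.clsOn T, F.clsOn (U \ T), F.clsOn (Set.univ \ U))),
    enum_bind (F.RelClosed Set.univ) (fun U T => F.RelClosed (Set.univ \ U) T)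
      (fun U T => (F.clsOn U, F.clsOn T,
        F.clsOn ((Set.univ \ U) \ T)))]
  refine enum_map_congr (fun x => (x.2, x.1 \ x.2)) (fun x => (x.1 ∪ x.2, x.1)) ?_ ?_ ?_ ?_ ?_
  · rintro ⟨U, T⟩ ⟨⟨-, hU⟩, ⟨hTU, hT⟩⟩
    refine ⟨⟨Set.subset_univ _, fun v _ w hw h => hT v (hU v trivial w (hTU hw) h) w hw h⟩, ?_, ?_⟩
    · exact fun v hv => ⟨trivial, hv.2⟩
    · exact fun v hv w hw h => ⟨hU v trivial w hw.1 h, hv.2⟩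
  · rintro ⟨U, T⟩ ⟨⟨-, hU⟩, ⟨hTU, hT⟩⟩
    refine ⟨⟨Set.subset_univ _, ?_⟩, Set.subset_union_left, ?_⟩
    · rintro v - w (hw | hw) h
      · exact Or.inl (hU v trivial w hw h)
      · by_cases hv : v ∈ U
        · exact Or.inl hv
        · exact Or.inr (hT v ⟨trivial, hv⟩ w hw h)
    · exact fun v _ w hw h => hU v trivial w hw h
  · rintro ⟨U, T⟩ ⟨-, ⟨hTU, -⟩⟩
    simp only [Set.union_sdiff_cancel hTU]
  · rintro ⟨U, T⟩ ⟨-, ⟨hTU, -⟩⟩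
    have : (U ∪ T) \ U = T := by
      rw [Set.union_sdiff_cancel_left]
      rintro x ⟨hx, hx'⟩
      exact (hTU hx').2 hx
    simp only [this]
  · rintro ⟨U, T⟩ ⟨-, ⟨hTU, -⟩⟩
    have : (Set.univ \ T) \ (U \ T) = Set.univ \ U := by
      ext x
      simp only [Set.mem_sdiff, Set.mem_univ, true_and]
      exact ⟨fun h hU => h.2 ⟨hU, h.1⟩, fun h => ⟨fun hT => h (hTU hT), fun h' => h h'.1⟩⟩
    simp only [this]

theorem cls_restrict_concat (F : PreorderedForest V) (G : PreorderedForest W) (S : Set V)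
    (T : Set W) : (F.concat G).clsOn (Sum.inl '' S ∪ Sum.inr '' T) =
      mul (F.clsOn S) (G.clsOn T) := by
  have h : (F.restrict S).concat (G.restrict T) =
      (F.concat G).comap (Sum.map (Subtype.val : S → V) (Subtype.val : T → W))
        (Subtype.val_injective.sumMap Subtype.val_injective) := by
    ext v w <;> rcases v with v | v <;> rcases w with w | w <;> simp [concat, comap, restrict]
  rw [clsOn, clsOn, clsOn, mul_cls, h]
  refine cls_comap_congr _ _ _ ?_
  ext x
  rcases x with x | x <;> simp

theorem comul_mul (x y : POForest) :
    comul (mul x y) = (comul x).bind fun p => (comul y).map fun q =>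
      (mul p.1 q.1, mul p.2 q.2) := by
  obtain ⟨n, F, rfl⟩ := exists_cls x
  obtain ⟨m, G, rfl⟩ := exists_cls y
  rw [mul_cls, comul_cls, comul_cls, comul_cls, cutTerms_eq_closed, cutTerms_eq_closed,
    cutTerms_eq_closed, Multiset.bind_map]
  simp only [Multiset.map_map, Function.comp_def]
  rw [enum_bind (F.RelClosed Set.univ) (fun _ => G.RelClosed Set.univ)
    (fun U T => (mul (F.clsOn U) (G.clsOn T),
      mul (F.clsOn (Set.univ \ U)) (G.clsOn (Set.univ \ T))))]
  refine enum_map_congr (fun U => (Sum.inl ⁻¹' U, Sum.inr ⁻¹' U))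
    (fun x => Sum.inl '' x.1 ∪ Sum.inr '' x.2) ?_ ?_ ?_ ?_ ?_
  · rintro U ⟨-, hU⟩
    exact ⟨⟨Set.subset_univ _, fun v _ w hw h => hU (.inl v) trivial (.inl w) hw (.inl h)⟩,
      ⟨Set.subset_univ _, fun v _ w hw h => hU (.inr v) trivial (.inr w) hw (.inr h)⟩⟩
  · rintro ⟨U, T⟩ ⟨⟨-, hU⟩, ⟨-, hT⟩⟩
    refine ⟨Set.subset_univ _, ?_⟩
    rintro v - w hw h
    cases h with
    | inl h => simp at hw ⊢; exact hU _ trivial _ hw h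
    | inr h => simp at hw ⊢; exact hT _ trivial _ hw h
  · intro U _
    ext x
    rcases x with x | x <;> simp
  · rintro ⟨U, T⟩ _
    refine Prod.ext ?_ ?_ <;> ext x <;> simp
  · intro U _
    rw [← cls_restrict_concat, ← cls_restrict_concat]
    have h1 : Sum.inl '' (Sum.inl ⁻¹' U) ∪ Sum.inr '' (Sum.inr ⁻¹' U) = U := by
      ext x
      rcases x with x | x <;> simp
    have h2 : Sum.inl '' (Set.univ \ Sum.inl ⁻¹' U) ∪ Sum.inr '' (Set.univ \ Sum.inr ⁻¹' U) =
        Set.univ \ U := by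
      ext x
      rcases x with x | x <;> simp
    rw [h1, h2]

theorem deg_eq_zero (x : POForest) : deg x = 0 ↔ x = empty.cls := by
  constructor
  · obtain ⟨n, F, rfl⟩ := exists_cls x
    intro h
    rw [deg_cls, Nat.card_fin] at h
    subst h
    exact cls_of_isEmpty F
  · rintro rfl
    simp [deg_cls]

theorem deg_restrict (F : PreorderedForest V) (S : Set V) : deg (F.clsOn S) = S.ncard :=
  rfl

noncomputable instance : HopfBasis POForest where
  one := empty.cls
  mul x y := {mul x y}
  comul := comul
  deg := deg
  one_mul x := by rw [one_mul]
  mul_one x := by rw [mul_one]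
  mul_assoc x y z := by simp [mul_assoc]
  comul_one := by
    rw [comul_cls, cutTerms_eq_closed, enum_eq_singleton (a := ∅), Multiset.map_singleton,
      clsOn_empty, Set.eq_empty_of_isEmpty (Set.univ \ ∅), clsOn_empty]
    intro T
    constructor
    · intro _
      exact Set.eq_empty_of_isEmpty T
    · rintro rfl
      exact ⟨Set.subset_univ _, fun v => v.elim⟩
  comul_mul x y := by
    simp [comul_mul, Multiset.bind_singleton]
  coassoc := coassoc
  filter_left x := by
    obtain ⟨n, F, rfl⟩ := exists_cls x
    rw [comul_cls, cutTerms_eq_closed, Multiset.filter_map, filter_enum,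
      enum_eq_singleton (a := ∅), Multiset.map_singleton, clsOn_empty]
    · rw [Set.sdiff_empty, clsOn_univ]
    · intro T
      simp only [Function.comp_apply, deg_restrict]
      rw [Set.ncard_eq_zero]
      refine ⟨fun h => h.2, ?_⟩
      rintro rfl
      exact ⟨⟨Set.subset_univ _, fun v _ w hw => hw.elim⟩, rfl⟩
  filter_right x := by
    obtain ⟨n, F, rfl⟩ := exists_cls x
    rw [comul_cls, cutTerms_eq_closed, Multiset.filter_map, filter_enum,
      enum_eq_singleton (a := Set.univ), Multiset.map_singleton, Set.sdiff_self,
      clsOn_empty]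
    · rw [clsOn_univ]
    · intro T
      simp only [Function.comp_apply, deg_restrict]
      rw [Set.ncard_eq_zero, Set.sdiff_eq_empty, Set.univ_subset_iff]
      refine ⟨fun h => h.2, ?_⟩
      rintro rfl
      exact ⟨⟨Set.subset_univ _, fun v _ w _ _ => trivial⟩, rfl⟩
  deg_eq_zero := deg_eq_zero
  deg_mul x y z hz := by
    obtain ⟨n, F, rfl⟩ := exists_cls x
    obtain ⟨m, G, rfl⟩ := exists_cls y
    rw [Multiset.mem_singleton.1 hz, mul_cls, deg_cls, deg_cls, deg_cls, Nat.card_sum]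
  deg_comul x p hp := by
    obtain ⟨n, F, rfl⟩ := exists_cls x
    rw [comul_cls, cutTerms_eq_closed] at hp
    obtain ⟨T, _, rfl⟩ := Multiset.mem_map.1 hp
    rw [deg_restrict, deg_restrict, deg_cls, ← Set.compl_eq_univ_sdiff, Set.ncard_add_ncard_compl]

end POForest

namespace PreorderedForest

variable {V W : Type}

instance (F : PreorderedForest V) : IsPreorder V F.le where
  refl v := (F.le_total v v).elim id id
  trans := F.le_trans

/-- The surjection `σ : V(F) → {1, …, q}` associated with the total preorder of `F`: the rank of the
class of `v` among the classes of the relation "`x ≤ y` and `y ≤ x`", i.e. the number of classes of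
vertices which are `≤ v`. -/
noncomputable def label (F : PreorderedForest V) (v : V) : ℕ :=
  (toAntisymmetrization F.le '' {w | F.le w v}).ncard

/-- The number `q = max(F)` of classes of the total preorder. -/
noncomputable def max (F : PreorderedForest V) : ℕ := Nat.card (Antisymmetrization V F.le)

theorem label_le_label_iff [Finite V] (F : PreorderedForest V) (v w : V) :
    F.label v ≤ F.label w ↔ F.le v w := by
  constructor
  · intro h
    by_contra hvw
    refine absurd h (not_le.2 (Set.ncard_lt_ncard ?_ (Set.toFinite _)))
    have hwv := (F.le_total v w).resolve_left hvw
    refine (Set.ssubset_iff_of_subset (Set.image_mono fun x hx => F.le_trans _ _ _ hx hwv)).2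
      ⟨toAntisymmetrization F.le v, ⟨v, refl_of F.le v, rfl⟩, ?_⟩
    rintro ⟨x, hx, hxv⟩
    exact hvw (F.le_trans _ _ _ (Quotient.exact hxv).2 hx)
  · intro h
    exact Set.ncard_le_ncard (Set.image_mono fun x hx => F.le_trans _ _ _ hx h) (Set.toFinite _)

theorem range_label [Finite V] (F : PreorderedForest V) :
    Set.range F.label = Set.Icc 1 F.max := by
  have heq : ∀ v w, F.label v = F.label w ↔
      toAntisymmetrization F.le v = toAntisymmetrization F.le w := by
    intro v w
    rw [le_antisymm_iff, label_le_label_iff, label_le_label_iff]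
    exact ⟨fun h => Quotient.sound h, fun h => Quotient.exact h⟩
  refine Set.eq_of_subset_of_ncard_le ?_ ?_ (Set.toFinite _)
  · rintro _ ⟨v, rfl⟩
    refine ⟨(Set.ncard_pos (Set.toFinite _)).2 ⟨_, v, refl_of F.le v, rfl⟩, ?_⟩
    have : Finite (Antisymmetrization V F.le) := Quotient.finite _
    rw [max, ← Set.ncard_univ]
    exact Set.ncard_le_ncard (Set.subset_univ _) (Set.toFinite _)
  · let g : Antisymmetrization V F.le → ℕ :=
      Quotient.lift F.label fun v w h => (heq v w).2 (Quotient.sound h)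
    have hg : Function.Injective g := by
      intro a b
      induction a using Quotient.inductionOn
      induction b using Quotient.inductionOn
      exact fun h => (heq _ _).1 h
    have hr : Set.range g ⊆ Set.range F.label := by
      rintro _ ⟨a, rfl⟩
      induction a using Quotient.inductionOn with
      | h v => exact ⟨v, rfl⟩
    have : (Set.range g).ncard = F.max := Nat.card_range_of_injective hg
    calc (Set.Icc 1 F.max).ncard = F.max := by simp [← Nat.card_coe_set_eq]
      _ = (Set.range g).ncard := this.symm
      _ ≤ _ := Set.ncard_le_ncard hr (Set.finite_range _)

/-- The set of bijections `φ : V(F) → {1, …, n}` (the positions of the letters of the word `τ` of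
length `n`) such that `σ(v) = τ(φ(v))` for every vertex `v`, and `φ(v) ≥ φ(v')` whenever there is an
oriented path from `v'` down to `v`. -/
def compatible (F : PreorderedForest V) (τ : PackedWord) : Set (V ≃ Fin τ.val.length) :=
  {φ | (∀ v, F.label v = τ.val.get (φ v)) ∧ ∀ v v', F.Reaches v' v → φ v' ≤ φ v}

theorem label_comap (F : PreorderedForest V) (e : W ≃ V) (w : W) :
    (F.comap e e.injective).label w = F.label (e w) := by
  let g : Antisymmetrization W (F.comap e e.injective).le → Antisymmetrization V F.le :=
    Quotient.map e fun _ _ h => h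
  have hg : Function.Injective g := by
    intro a b
    induction a using Quotient.inductionOn
    induction b using Quotient.inductionOn
    intro h
    exact Quotient.sound (show AntisymmRel _ _ _ from Quotient.exact (s := AntisymmRel.setoid V F.le) h)
  rw [label, ← Set.ncard_image_of_injective _ hg, label, Set.image_image]
  congr 1
  ext a
  constructor
  · rintro ⟨x, hx, rfl⟩
    exact ⟨e x, hx, rfl⟩
  · rintro ⟨x, hx, rfl⟩
    refine ⟨e.symm x, ?_, ?_⟩
    · change F.le (e (e.symm x)) (e w)
      rwa [e.apply_symm_apply]
    · change toAntisymmetrization F.le (e (e.symm x)) = _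
      rw [e.apply_symm_apply]

theorem reaches_comap (F : PreorderedForest V) (e : W ≃ V) (v w : W) :
    (F.comap e e.injective).Reaches v w ↔ F.Reaches (e v) (e w) := by
  constructor
  · exact fun h => h.lift e fun _ _ h => h
  · intro h
    have h' : (F.comap e e.injective).Reaches (e.symm (e v)) (e.symm (e w)) :=
      Relation.ReflTransGen.lift (r := F.edge) (p := (F.comap e e.injective).edge) e.symm
        (fun a b h => by simpa [comap, Function.onFun] using h) _ _ h
    simpa using h'

theorem card_compatible_comap (F : PreorderedForest V) (e : W ≃ V) (τ : PackedWord) :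
    Nat.card ((F.comap e e.injective).compatible τ) = Nat.card (F.compatible τ) := by
  refine Nat.card_congr ((Equiv.equivCongr e (Equiv.refl _)).subtypeEquiv fun φ => ?_)
  simp only [compatible, Set.mem_ofPred_eq, label_comap, reaches_comap]
  constructor
  · rintro ⟨h1, h2⟩
    exact ⟨fun v => by simpa using h1 (e.symm v),
      fun v v' h => by simpa using h2 (e.symm v) (e.symm v') (by simpa using h)⟩
  · rintro ⟨h1, h2⟩
    exact ⟨fun v => by simpa using h1 (e v), fun v v' h => by simpa using h2 _ _ h⟩

end PreorderedForest

namespace PackedWord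

theorem finite_length_eq (n : ℕ) : {τ : PackedWord | τ.length = n}.Finite := by
  refine Set.Finite.of_injOn (f := PackedWord.val)
    (t := List.map Fin.val '' {l : List (Fin (n + 1)) | l.length = n}) ?_ val_injective.injOn
    ((List.finite_length_eq _ n).image _)
  rintro τ hτ
  simp only [Set.mem_ofPred_eq, length] at hτ
  obtain ⟨k, hk⟩ := τ.isPacked
  have hkn : k ≤ n := by
    have := List.toFinset_card_le τ.val
    rw [hk, hτ] at this
    simpa using this
  have hle : ∀ a ∈ τ.val, a < n + 1 := fun a ha => by
    have : a ∈ Finset.Icc 1 k := by rw [← hk]; simpa using ha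
    have := (Finset.mem_Icc.1 this).2
    omega
  refine ⟨τ.val.pmap Fin.mk hle, by simpa using hτ, ?_⟩
  simp [List.map_pmap]

/-- The set `Surj_n` of packed words of length `n`. -/
noncomputable def surj (n : ℕ) : Finset PackedWord := (finite_length_eq n).toFinset

end PackedWord

/-- The Hopf algebra `H_po` of preordered forests. -/
abbrev Hpo (K : Type*) [CommRing K] : Type _ := CombAlg K POForest

/-- The Hopf algebra `WQSym*` of free packed words. -/
abbrev WQSymStar (K : Type*) [CommRing K] : Type _ := CombAlg K PackedWord

/-- `∑ card(S^τ_F) τ`, where `τ` runs over the packed words whose length is the number of vertices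
of `F`. -/
noncomputable def PreorderedForest.phi (K : Type*) [CommRing K] {V : Type}
    (F : PreorderedForest V) : WQSymStar K :=
  ∑ τ ∈ PackedWord.surj (Nat.card V), (Nat.card (F.compatible τ) : K) • CombAlg.of τ

/-- `PreorderedForest.phi` on isomorphism classes. -/
noncomputable def POForest.phi (K : Type*) [CommRing K] : POForest → WQSymStar K :=
  Quotient.lift (fun a => a.2.phi K) fun a b ⟨e, h⟩ => by
    simp only [PreorderedForest.phi, h, PreorderedForest.card_compatible_comap, Nat.card_congr e]

/-- The linear map `Φ : H_po → WQSym*`, defined on the basis of preordered forests by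
`Φ(F) = ∑ card(S^τ_F) τ`. -/
noncomputable def Phi (K : Type*) [CommRing K] : Hpo K →ₗ[K] WQSymStar K :=
  CombAlg.lift (POForest.phi K)

theorem Phi_of_cls (K : Type*) [CommRing K] {V : Type} [Finite V] (F : PreorderedForest V) :
    Phi K (CombAlg.of F.cls) = ∑ τ ∈ PackedWord.surj (Nat.card V),
      (Nat.card (F.compatible τ) : K) • CombAlg.of τ := by
  rw [Phi, CombAlg.lift_of]
  change PreorderedForest.phi K 
    (F.comap (Finite.equivFin V).symm (Finite.equivFin V).symm.injective) = _
  simp only [PreorderedForest.phi, PreorderedForest.card_compatible_comap, Nat.card_fin]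

/-! A bijection `φ` in `F.compatible τ` is the same thing as the word of vertices `φ⁻¹(1) φ⁻¹(2) …`.
Condition 2 says that this word is a linear extension of `F`: every vertex occurs once, and before
its parent. Condition 1 says that reading labels along it gives `τ`. Hence `Φ(F)` is the sum, over
the linear extensions `l` of `F`, of the label word of `l` (`card_compatible`, `phi_eq_ofM`), and
compatibility with the structure becomes a bijection between linear extensions.

Product: no edge joins `F` to `G`, so the linear extensions of `FG` are the interleavings of one of
`F` and one of `G` (`linExts_concat`). On labels, those of `G` being shifted by `max(F)`, this is
the shuffle product of `WQSym*`.

Coproduct: the letters of a prefix of a linear extension form a set `T` that contains all vertices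
above its elements. Cutting linear extensions at all positions therefore amounts to choosing such a
`T`, a linear extension of `T` and one of its complement (`linExts_bind_splits`). By
`cutTerms_eq_closed` these sets `T` are the sets `F.lea c`, one for each admissible cut `c`.

The label of a vertex changes when one passes to a subforest or to a product, but packing absorbs
this: any function into `ℕ` that induces the preorder yields the same packed word
(`ofWord_map_label_congr`).

Unit, counit and degree follow from the fact that `Φ(F)` only involves words with as many letters as
`F` has vertices. The antipode comes for free, by uniqueness of convolution inverses. -/

/-! ### Interleavings of words over two disjoint alphabets -/

/-- The interleavings of two words, i.e. the words whose letters from the first alphabet form the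
first word and whose letters from the second alphabet form the second word. -/
def interleave {α β : Type*} : List α → List β → Multiset (List (α ⊕ β))
  | [], v => {v.map Sum.inr}
  | a :: u, [] => {(a :: u).map Sum.inl}
  | a :: u, b :: v =>
      (interleave u (b :: v)).map (List.cons (Sum.inl a)) +
        (interleave (a :: u) v).map (List.cons (Sum.inr b))
  termination_by u v => u.length + v.length

namespace Interleave

variable {α β : Type*}

@[simp] theorem interleave_nil_left (v : List β) :
    interleave ([] : List α) v = {v.map Sum.inr} := by
  rw [interleave]

@[simp] theorem interleave_nil_right (u : List α) :
    interleave u ([] : List β) = {u.map Sum.inl} := by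
  cases u <;> rw [interleave]; rfl

theorem interleave_cons (a : α) (u : List α) (b : β) (v : List β) :
    interleave (a :: u) (b :: v) =
      (interleave u (b :: v)).map (List.cons (Sum.inl a)) +
        (interleave (a :: u) v).map (List.cons (Sum.inr b)) := by
  rw [interleave]

/-- Interleavings remember the origin of each letter, so they are pairwise distinct; forgetting the
origin recovers shuffles with their multiplicities. This allows multiplicities to be handled by
comparing sets. -/
theorem map_interleave (f : α → ℕ) (g : β → ℕ) (u : List α) (v : List β) :
    (interleave u v).map (List.map (Sum.elim f g)) = shuffle (u.map f) (v.map g) := by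
  induction u generalizing v with
  | nil => simp
  | cons a u ihu =>
    induction v with
    | nil => simp
    | cons b v ihv =>
      have h := ihu (b :: v)
      simp only [List.map_cons] at h ihv ⊢
      rw [interleave_cons, WordLemmas.shuffle_cons, ← h, ← ihv]
      simp [Multiset.map_map, Function.comp_def]

theorem filterMap_getLeft_map_inr (v : List β) :
    (v.map (Sum.inr : β → α ⊕ β)).filterMap Sum.getLeft? = [] := by
  simp [List.filterMap_map, List.filterMap_eq_nil_iff]

theorem filterMap_getRight_map_inl (u : List α) :
    (u.map (Sum.inl : α → α ⊕ β)).filterMap Sum.getRight? = [] := by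
  simp [List.filterMap_map, List.filterMap_eq_nil_iff]

theorem filterMap_getLeft_map_inl (u : List α) :
    (u.map (Sum.inl : α → α ⊕ β)).filterMap Sum.getLeft? = u := by
  induction u <;> simp_all

theorem filterMap_getRight_map_inr (v : List β) :
    (v.map (Sum.inr : β → α ⊕ β)).filterMap Sum.getRight? = v := by
  induction v <;> simp_all

theorem eq_map_inr {l : List (α ⊕ β)} (h : l.filterMap Sum.getLeft? = []) :
    l = (l.filterMap Sum.getRight?).map Sum.inr := by
  induction l with
  | nil => rfl
  | cons x l ih =>
    rcases x with x | x
    · simp at h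
    · rw [List.filterMap_cons_none rfl] at h
      exact congrArg (List.cons _) (ih h)

theorem eq_map_inl {l : List (α ⊕ β)} (h : l.filterMap Sum.getRight? = []) :
    l = (l.filterMap Sum.getLeft?).map Sum.inl := by
  induction l with
  | nil => rfl
  | cons x l ih =>
    rcases x with x | x
    · rw [List.filterMap_cons_none rfl] at h
      exact congrArg (List.cons _) (ih h)
    · simp at h

/-- Every word over `α ⊕ β` interleaves exactly one pair, its left part and its right part. The
first letter of `l` decides which summand of the recursion it comes from. -/
theorem mem_interleave {u : List α} {v : List β} {l : List (α ⊕ β)} :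
    l ∈ interleave u v ↔ l.filterMap Sum.getLeft? = u ∧ l.filterMap Sum.getRight? = v := by
  induction u generalizing v l with
  | nil =>
    rw [interleave_nil_left, Multiset.mem_singleton]
    constructor
    · rintro rfl
      exact ⟨filterMap_getLeft_map_inr v, filterMap_getRight_map_inr v⟩
    · rintro ⟨h, rfl⟩
      exact eq_map_inr h
  | cons a u ihu =>
    induction v generalizing l with
    | nil =>
      rw [interleave_nil_right, Multiset.mem_singleton]
      constructor
      · rintro rfl
        exact ⟨filterMap_getLeft_map_inl _, filterMap_getRight_map_inl _⟩
      · rintro ⟨h, h'⟩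
        rw [← h]
        exact eq_map_inl h'
    | cons b v ihv =>
      rw [interleave_cons, Multiset.mem_add, Multiset.mem_map, Multiset.mem_map]
      simp only [ihu, ihv]
      constructor
      · rintro (⟨x, ⟨h, h'⟩, rfl⟩ | ⟨x, ⟨h, h'⟩, rfl⟩) <;>
          simp [List.filterMap_cons, h, h']
      · rintro ⟨h, h'⟩
        rcases l with _ | ⟨x | x, l⟩
        · simp at h
        · simp only [List.filterMap_cons, Sum.getLeft?_inl, Sum.getRight?_inl,
            List.cons.injEq] at h h'
          exact Or.inl ⟨l, ⟨h.2, h'⟩, by rw [h.1]⟩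
        · simp only [List.filterMap_cons, Sum.getLeft?_inr, Sum.getRight?_inr,
            List.cons.injEq] at h h'
          exact Or.inr ⟨l, ⟨h, h'.2⟩, by rw [h'.1]⟩

theorem nodup_interleave (u : List α) (v : List β) : (interleave u v).Nodup := by
  induction u generalizing v with
  | nil => simp
  | cons a u ihu =>
    induction v with
    | nil => simp
    | cons b v ihv =>
      rw [interleave_cons, Multiset.nodup_add]
      refine ⟨(ihu _).map List.cons_injective, ihv.map List.cons_injective, ?_⟩
      -- The two summands are disjoint because their words start with letters from different
      -- alphabets.
      refine Multiset.disjoint_left.2 fun {x} hx hx' => ?_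
      obtain ⟨y, _, rfl⟩ := Multiset.mem_map.1 hx
      obtain ⟨z, _, hz⟩ := Multiset.mem_map.1 hx'
      simp at hz

theorem nodup_iff_filterMap (l : List (α ⊕ β)) :
    l.Nodup ↔ (l.filterMap Sum.getLeft?).Nodup ∧ (l.filterMap Sum.getRight?).Nodup := by
  induction l with
  | nil => simp
  | cons x l ih => rcases x with x | x <;> simp [ih] <;> tauto

/-- `Sum.LiftRel` never relates a left letter to a right one, so the order in which letters of
different alphabets appear is unconstrained. -/
theorem pairwise_iff_filterMap (R : α → α → Prop) (S : β → β → Prop) (l : List (α ⊕ β)) :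
    l.Pairwise (fun x y => ¬ Sum.LiftRel R S y x) ↔
      (l.filterMap Sum.getLeft?).Pairwise (fun x y => ¬ R y x) ∧
        (l.filterMap Sum.getRight?).Pairwise (fun x y => ¬ S y x) := by
  induction l with
  | nil => simp
  | cons x l ih => rcases x with x | x <;> simp [ih] <;> tauto

end Interleave

/-! ### Linear extensions of forests -/

namespace PreorderedForest

open ForestLemmas

variable {V W : Type}

/-- The words without repetition whose letters are the elements of `S`, such that every vertex comes
before its parent. -/
def IsLinExt (F : PreorderedForest V) (S : Set V) (l : List V) : Prop :=
  l.Nodup ∧ (∀ v, v ∈ l ↔ v ∈ S) ∧ l.Pairwise fun a b => ¬ F.edge b a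

theorem finite_isLinExt [Finite V] (F : PreorderedForest V) (S : Set V) :
    {l | F.IsLinExt S l}.Finite := by
  cases nonempty_fintype V
  exact (List.finite_length_le V (Fintype.card V)).subset fun l h => h.1.length_le_card

/-- The linear extensions of the restriction of `F` to `S`. -/
noncomputable def linExts [Finite V] (F : PreorderedForest V) (S : Set V) : Multiset (List V) :=
  (F.finite_isLinExt S).toFinset.val

variable [Finite V] [Finite W]

@[simp] theorem mem_linExts {F : PreorderedForest V} {S : Set V} {l : List V} :
    l ∈ F.linExts S ↔ F.IsLinExt S l := by simp [linExts]

theorem nodup_linExts (F : PreorderedForest V) (S : Set V) : (F.linExts S).Nodup :=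
  Finset.nodup _

/-- The edges of the restriction are exactly the edges of `F` inside `S`, and only those constrain a
word with letters in `S`. Linear extensions of subforests can thus be kept as words over `V`, with
no subtypes. -/
theorem map_linExts_restrict (F : PreorderedForest V) (S : Set V) :
    ((F.restrict S).linExts Set.univ).map (List.map Subtype.val) = F.linExts S := by
  refine (Multiset.Nodup.ext ((nodup_linExts _ _).map (List.map_injective_iff.2
    Subtype.val_injective)) (nodup_linExts _ _)).2 fun l => ?_
  rw [Multiset.mem_map, mem_linExts]
  constructor
  · rintro ⟨x, hx, rfl⟩
    obtain ⟨h1, h2, h3⟩ := mem_linExts.1 hx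
    refine ⟨h1.map Subtype.val_injective, fun v => ?_, List.pairwise_map.2 h3⟩
    simp only [List.mem_map]
    exact ⟨fun ⟨y, _, hy⟩ => hy ▸ y.2, fun hv => ⟨⟨v, hv⟩, (h2 _).2 trivial, rfl⟩⟩
  · rintro ⟨h1, h2, h3⟩
    lift l to List S using fun v hv => (h2 v).1 hv
    refine ⟨l, mem_linExts.2 ⟨h1.of_map _, fun v => ⟨fun _ => trivial, fun _ => ?_⟩,
      List.pairwise_map.1 h3⟩, rfl⟩
    obtain ⟨y, hy, hyv⟩ := List.mem_map.1 ((h2 v.1).2 v.2)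
    rwa [← Subtype.ext hyv]

/-- All edges stay inside `V` or inside `W`, so a word is a linear extension of `FG` exactly when
its two parts are linear extensions of `F` and `G`. Both multisets are duplicate-free, since the two
parts are determined by the word; comparing members then suffices. -/
theorem linExts_concat (F : PreorderedForest V) (G : PreorderedForest W) :
    (F.concat G).linExts Set.univ = (F.linExts Set.univ).bind fun u =>
      (G.linExts Set.univ).bind fun v => interleave u v := by
  refine (Multiset.Nodup.ext (nodup_linExts _ _) ?_).2 fun l => ?_
  · refine Multiset.nodup_bind.2 ⟨fun u _ => Multiset.nodup_bind.2
      ⟨fun v _ => Interleave.nodup_interleave u v, ?_⟩, ?_⟩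
    · refine (nodup_linExts _ _).pairwise fun a _ b _ hab => ?_
      refine Multiset.disjoint_left.2 fun {x} hx hx' => hab ?_
      rw [← (Interleave.mem_interleave.1 hx).2, (Interleave.mem_interleave.1 hx').2]
    · refine (nodup_linExts _ _).pairwise fun a _ b _ hab => ?_
      refine Multiset.disjoint_left.2 fun {x} hx hx' => hab ?_
      obtain ⟨_, _, h⟩ := Multiset.mem_bind.1 hx
      obtain ⟨_, _, h'⟩ := Multiset.mem_bind.1 hx'
      rw [← (Interleave.mem_interleave.1 h).1, (Interleave.mem_interleave.1 h').1]
  · have h : l ∈ ((F.linExts Set.univ).bind fun u => (G.linExts Set.univ).bind fun v =>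
        interleave u v) ↔ F.IsLinExt Set.univ (l.filterMap Sum.getLeft?) ∧
          G.IsLinExt Set.univ (l.filterMap Sum.getRight?) := by
      simp only [Multiset.mem_bind, mem_linExts, Interleave.mem_interleave]
      constructor
      · rintro ⟨_, h, _, h', rfl, rfl⟩
        exact ⟨h, h'⟩
      · rintro ⟨h, h'⟩
        exact ⟨_, h, _, h', rfl, rfl⟩
    rw [h, mem_linExts, IsLinExt, IsLinExt, IsLinExt, Interleave.nodup_iff_filterMap, concat,
      Interleave.pairwise_iff_filterMap]
    simp only [Sum.forall, Set.mem_univ, iff_true, List.mem_filterMap, Sum.exists,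
      Sum.getLeft?_inl, Sum.getLeft?_inr, Sum.getRight?_inl, Sum.getRight?_inr,
      Option.some.injEq, reduceCtorEq, and_false, exists_false, or_false, false_or,
      exists_eq_right]
    tauto

/-- The ways to cut the linear extensions of `F` into a prefix and a suffix. -/
theorem linExts_bind_splits (F : PreorderedForest V) :
    ((F.linExts Set.univ).bind fun l =>
        (Multiset.range (l.length + 1)).map fun k => (l.take k, l.drop k)) =
      (enum (F.RelClosed Set.univ)).bind fun T => (F.linExts T).bind fun u =>
        (F.linExts (Set.univ \ T)).map fun v => (u, v) := by
  have hs : ∀ (l : List V) (p : List V × List V),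
      p ∈ ((Multiset.range (l.length + 1)).map fun k => (l.take k, l.drop k)) ↔
        p.1 ++ p.2 = l := by
    rintro l ⟨u, v⟩
    simp only [Multiset.mem_map, Multiset.mem_range]
    constructor
    · rintro ⟨k, _, h⟩
      cases h
      simp
    · rintro rfl
      exact ⟨u.length, by simp, by simp⟩
  refine (Multiset.Nodup.ext ?_ ?_).2 ?_
  · refine Multiset.nodup_bind.2 ⟨fun l _ => ?_, ?_⟩
    -- Since `k` does not exceed the length of the word, it is the length of the prefix; different
    -- positions give different pairs.
    · refine (Multiset.nodup_range _).map_on fun i hi j hj hij => ?_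
      have h := congrArg (fun p : List V × List V => p.1.length) hij
      rw [Multiset.mem_range] at hi hj
      simp only [List.length_take] at h
      omega
    · refine (nodup_linExts _ _).pairwise fun a _ b _ hab => ?_
      refine Multiset.disjoint_left.2 fun {x} hx hx' => hab ?_
      rw [← (hs _ _).1 hx, (hs _ _).1 hx']
  · refine Multiset.nodup_bind.2 ⟨fun T _ => Multiset.nodup_bind.2 ⟨fun u _ =>
      (nodup_linExts _ _).map (Prod.mk_right_injective u), ?_⟩, ?_⟩
    · refine (nodup_linExts _ _).pairwise fun a _ b _ hab => ?_
      refine Multiset.disjoint_left.2 fun {x} hx hx' => hab ?_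
      obtain ⟨_, _, rfl⟩ := Multiset.mem_map.1 hx
      obtain ⟨_, _, h⟩ := Multiset.mem_map.1 hx'
      exact (congrArg Prod.fst h).symm
    · refine (nodup_enum _).pairwise fun S _ T _ hST => ?_
      refine Multiset.disjoint_left.2 fun {x} hx hx' => hST ?_
      simp only [Multiset.mem_bind, Multiset.mem_map, mem_linExts] at hx hx'
      obtain ⟨u, hu, _, _, rfl⟩ := hx
      obtain ⟨u', hu', _, _, h⟩ := hx'
      cases h
      -- `T` can be read off a pair `(u, v)`: it is the set of letters of `u`.
      ext v
      rw [← hu.2.1, hu'.2.1]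
  · rintro ⟨u, v⟩
    simp only [Multiset.mem_bind, hs, mem_linExts, mem_enum, Multiset.mem_map,
      Prod.mk.injEq, exists_eq_right_right, exists_eq_right']
    constructor
    · rintro ⟨h1, h2, h3⟩
      rw [List.nodup_append] at h1
      rw [List.pairwise_append] at h3
      simp only [List.mem_append, Set.mem_univ, iff_true] at h2
      have hd : ∀ x, x ∈ u → x ∉ v := fun x hx hx' => h1.2.2 x hx x hx' rfl
      -- The set of letters of the prefix is closed: a child of a letter of `u` must come before it,
      -- so it cannot lie in `v`.
      refine ⟨{x | x ∈ u}, ⟨Set.subset_univ _, fun x _ y hy hxy => ?_⟩,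
        ⟨h1.1, fun _ => Iff.rfl, h3.1⟩, ⟨h1.2.1, fun x => ?_, h3.2.1⟩⟩
      · exact (h2 x).resolve_right fun hx => h3.2.2 y hy x hx hxy
      · have := h2 x
        have := hd x
        simp only [Set.mem_sdiff, Set.mem_univ, true_and, Set.mem_ofPred_eq]
        tauto
    · rintro ⟨T, ⟨-, hT⟩, ⟨h1, h2, h3⟩, ⟨h1', h2', h3'⟩⟩
      refine ⟨List.nodup_append.2 ⟨h1, h1', fun x hx y hy hxy => ?_⟩, fun x => ?_,
        List.pairwise_append.2 ⟨h3, h3', fun x hx y hy hxy => ?_⟩⟩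
      · subst hxy
        exact ((h2' x).1 hy).2 ((h2 x).1 hx)
      · rw [List.mem_append, h2, h2']
        simp [Classical.em]
      -- Conversely, a bad pair across the cut would be a vertex outside `T` whose parent is in `T`,
      -- contradicting closedness.
      · exact ((h2' y).1 hy).2 (hT y trivial x ((h2 x).1 hx) hxy)

end PreorderedForest

/-! ### `Φ` as a sum over linear extensions -/

theorem CombAlg.ofM_eq_sum_count {K : Type*} [CommRing K] {B : Type} [DecidableEq B]
    {m : Multiset B} {s : Finset B} (h : ∀ x ∈ m, x ∈ s) :
    (CombAlg.ofM m : CombAlg K B) = ∑ x ∈ s, (m.count x : K) • CombAlg.of x := by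
  rw [ofM, Finset.sum_multiset_map_count]
  refine (Finset.sum_subset (fun x hx => h x (Multiset.mem_toFinset.1 hx)) fun x _ hx => ?_).trans
    (Finset.sum_congr rfl fun x _ => (Nat.cast_smul_eq_nsmul K _ _).symm)
  rw [Multiset.count_eq_zero_of_notMem (by simpa using hx), zero_smul]

theorem PackedWord.mem_surj {n : ℕ} {τ : PackedWord} : τ ∈ PackedWord.surj n ↔ τ.length = n := by
  simp [PackedWord.surj]

namespace PreorderedForest

open ForestLemmas

variable {V W : Type} [Finite V] [Finite W]

/-- Packing only sees the relative order of the letters, and `f` orders the vertices as `F.label`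
does. This makes it unnecessary to compute the labels of a subforest or of a product. -/
theorem ofWord_map_label_congr (F : PreorderedForest V) {f : V → ℕ}
    (hf : ∀ v w, f v ≤ f w ↔ F.le v w) (l : List V) :
    PackedWord.ofWord (l.map f) = PackedWord.ofWord (l.map F.label) := by
  have hlt : ∀ v w, F.label v < F.label w → f v < f w := fun v w h => by
    rw [← not_le, F.label_le_label_iff] at h
    rwa [← not_le, hf]
  -- `f` factors through `F.label`: equal labels mean equivalent vertices, on which `f` agrees. The
  -- default value `0` is only taken on numbers that are not labels, hence never on letters of the
  -- word.
  have hg : ∀ v, Function.extend F.label f 0 (F.label v) = f v := fun v =>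
    Function.FactorsThrough.extend_apply (fun a b h => le_antisymm
      ((hf _ _).2 ((F.label_le_label_iff _ _).1 h.le))
      ((hf _ _).2 ((F.label_le_label_iff _ _).1 h.ge))) _ _
  have h : l.map f = (l.map F.label).map (Function.extend F.label f 0) := by
    simp [hg]
  rw [h, PackedWord.ofWord, PackedWord.ofWord, PackedWord.mk.injEq]
  refine WordLemmas.pack_map ?_
  simp only [List.mem_map]
  rintro _ ⟨v, _, rfl⟩ _ ⟨w, _, rfl⟩ hvw
  rw [hg, hg]
  exact hlt v w hvw

/-- As every vertex occurs in `l`, the letters of the label word are all of `1, …, F.max` by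
`range_label`, so the word is already packed. -/
theorem val_ofWord_map_label (F : PreorderedForest V) {l : List V} (hl : ∀ v, v ∈ l) :
    (PackedWord.ofWord (l.map F.label)).val = l.map F.label := by
  refine WordLemmas.pack_eq_self ⟨F.max, ?_⟩
  ext a
  have h := congrArg (a ∈ ·) F.range_label
  simp only [Set.mem_range, Set.mem_Icc, eq_iff_iff] at h
  simp [hl, h]

theorem length_eq_natCard {l : List V} (h : l.Nodup) (hl : ∀ v, v ∈ l) :
    l.length = Nat.card V := by
  classical
  cases nonempty_fintype V
  rw [Nat.card_eq_fintype_card, ← Finset.card_univ, ← List.toFinset_card_of_nodup h]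
  congr 1
  ext
  simp [hl]

/-- The bijection sends `φ` to the word that lists the vertices in the order of their positions.
Paths versus edges makes no difference: the inequality along a path follows from those along its
edges. -/
theorem card_compatible (F : PreorderedForest V) (τ : PackedWord) :
    Nat.card (F.compatible τ) =
      {l | F.IsLinExt Set.univ l ∧ PackedWord.ofWord (l.map F.label) = τ}.ncard := by
  let g : (V ≃ Fin τ.val.length) → List V := fun φ => List.ofFn φ.symm
  have hg : Function.Injective g := fun φ ψ h =>
    Equiv.symm_bijective.injective (DFunLike.coe_injective (List.ofFn_injective h))
  rw [Nat.card_coe_set_eq, ← Set.ncard_image_of_injective _ hg]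
  congr 1
  ext l
  have hmem : ∀ φ v, v ∈ g φ := fun φ v => (List.mem_ofFn' _ _).2 ⟨φ v, by simp⟩
  constructor
  · rintro ⟨φ, ⟨h1, h2⟩, rfl⟩
    refine ⟨⟨List.nodup_ofFn.2 φ.symm.injective, fun v => by simp [hmem],
      List.pairwise_ofFn.2 fun i j hij h => ?_⟩, PackedWord.ext ?_⟩
    · have := h2 _ _ (Relation.ReflTransGen.single h)
      simp only [Equiv.apply_symm_apply] at this
      omega
    · rw [val_ofWord_map_label F (hmem φ), List.map_ofFn]
      refine (congrArg List.ofFn (funext fun i => ?_)).trans (List.ofFn_get τ.val)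
      simp [h1]
  · rintro ⟨⟨h1, h2, h3⟩, rfl⟩
    have hl : ∀ v, v ∈ l := fun v => (h2 v).2 trivial
    have hv := val_ofWord_map_label F hl
    have hlen : (PackedWord.ofWord (l.map F.label)).val.length = l.length := by simp [hv]
    -- This `φ` goes from positions to vertices, so the compatible bijection is `φ.symm`. The cast
    -- is needed because the packed word and `l` have equal lengths only through `hv`.
    let φ := Equiv.ofBijective (fun i => l.get (Fin.cast hlen i))
      ⟨(List.nodup_iff_injective_get.1 h1).comp (Fin.cast_injective hlen), fun v => by
        obtain ⟨i, hi⟩ := List.get_of_mem (hl v)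
        exact ⟨Fin.cast hlen.symm i, hi⟩⟩
    have hφ : g φ.symm = l := by
      refine List.ext_getElem (by simp [g, hlen]) fun i _ _ => ?_
      simp [g, φ]
    refine ⟨φ.symm, ⟨fun v => ?_, fun v v' h => ?_⟩, hφ⟩
    · obtain ⟨i, rfl⟩ := φ.surjective v
      simp [φ, hv]
    · induction h using Relation.ReflTransGen.head_induction_on with
      | refl => rfl
      | @head a b hab _ ih =>
        refine _root_.le_trans ?_ ih
        -- If the parent `b` came strictly before its child `a`, this pair of positions would
        -- violate the pairwise condition on `l`.
        by_contra hlt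
        rw [← hφ] at h3
        refine List.pairwise_ofFn.1 h3 (not_le.1 hlt) ?_
        simpa using hab

/-- The coefficient of `τ` counts the linear extensions with label word `τ`, so grouping the terms
of the right-hand side by value gives the definition of `phi`. All label words have length `Nat.card
V`, so the index set of the sum misses none of them. -/
theorem phi_eq_ofM (K : Type*) [CommRing K] (F : PreorderedForest V) :
    F.phi K = CombAlg.ofM
      ((F.linExts Set.univ).map fun l => PackedWord.ofWord (l.map F.label)) := by
  classical
  rw [CombAlg.ofM_eq_sum_count (s := PackedWord.surj (Nat.card V)), phi]
  · refine Finset.sum_congr rfl fun τ _ => ?_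
    congr 2
    rw [card_compatible, Multiset.count_map, linExts, ← Finset.filter_val, Finset.card_val,
      ← Set.ncard_coe_finset]
    congr 1
    ext l
    simp [eq_comm]
  · intro x hx
    obtain ⟨l, hl, rfl⟩ := Multiset.mem_map.1 hx
    obtain ⟨h1, h2, h3⟩ := mem_linExts.1 hl
    rw [PackedWord.mem_surj, PackedWord.length, PackedWord.ofWord, WordLemmas.length_pack,
      List.length_map, length_eq_natCard h1 fun v => (h2 v).2 trivial]

theorem Phi_of_cls_eq_ofM (K : Type*) [CommRing K] (F : PreorderedForest V) {f : V → ℕ}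
    (hf : ∀ v w, f v ≤ f w ↔ F.le v w) : Phi K (CombAlg.of F.cls) = CombAlg.ofM
      ((F.linExts Set.univ).map fun l => PackedWord.ofWord (l.map f)) := by
  rw [Phi_of_cls]
  refine (phi_eq_ofM K F).trans ?_
  simp only [F.ofWord_map_label_congr hf]

/-- The labels of `F` restricted to `S` may have gaps, hence differ from the labels of the
subforest, but they induce its preorder, and packing closes the gaps. -/
theorem Phi_of_clsOn (K : Type*) [CommRing K] (F : PreorderedForest V) (S : Set V) :
    Phi K (CombAlg.of (F.clsOn S)) = CombAlg.ofM
      ((F.linExts S).map fun l => PackedWord.ofWord (l.map F.label)) := by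
  rw [clsOn, Phi_of_cls_eq_ofM K (F.restrict S) (f := fun v => F.label v)
    fun v w => F.label_le_label_iff v w, ← F.map_linExts_restrict S, Multiset.map_map]
  simp only [Function.comp_def, List.map_map]

end PreorderedForest

/-! ### Extension from the basis, and antipodes -/

namespace CombAlg

variable {K : Type*} [CommRing K] {B C : Type}

theorem map_mul_of_basis [HopfBasis B] [HopfBasis C] (f : CombAlg K B →ₗ[K] CombAlg K C)
    (h : ∀ a b : B, f (of a * of b) = f (of a) * f (of b)) (x y : CombAlg K B) :
    f (x * y) = f x * f y := by
  induction x using induction with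
  | h0 => simp
  | ha x x' h h' => simp [h, h', add_mul]
  | hs r x h => rw [smul_mul_assoc, map_smul, map_smul, h, smul_mul_assoc]
  | hof a =>
    induction y using induction with
    | h0 => simp
    | ha x x' h h' => simp [h, h', mul_add]
    | hs r x h => rw [mul_smul_comm, map_smul, map_smul, h, mul_smul_comm]
    | hof b => exact h a b

theorem ofM_tmul_ofM (m n : Multiset B) : (ofM m : CombAlg K B) ⊗ₜ[K] (ofM n : CombAlg K B) =
    ofM₂ (m.bind fun x => n.map fun y => (x, y)) := by
  rw [ofM₂_bind]
  refine (map_ofM ((TensorProduct.mk K _ _).flip (ofM n)) m).trans ?_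
  congr 1
  refine Multiset.map_congr rfl fun x _ => ?_
  refine (map_ofM (TensorProduct.mk K _ _ (of x)) n).trans ?_
  rw [ofM₂, Multiset.map_map]
  rfl

theorem ofM_mul_ofM [HopfBasis B] (m n : Multiset B) : (ofM m * ofM n : CombAlg K B) =
    ofM (m.bind fun x => n.bind fun y => HopfBasis.mul x y) := by
  rw [ofM_bind, mul_def, ← LinearMap.flip_apply, map_ofM]
  simp only [LinearMap.flip_apply, mulHom_of_ofM]

end CombAlg

/-- Morphisms of bialgebras between Hopf algebras commute with the antipodes. -/
theorem BialgHom.map_antipode {R A B : Type*} [CommRing R] [Ring A] [Ring B] [HopfAlgebra R A]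
    [HopfAlgebra R B] (f : A →ₐc[R] B) (x : A) :
    f (HopfAlgebra.antipode R x) = HopfAlgebra.antipode R (f x) := by
  -- In the convolution algebra of linear maps from `A` to `B`, the composite of the antipode of `A`
  -- with `f` is a left inverse of `f` (`h1`), and the composite of `f` with the antipode of `B` is
  -- a right inverse (`h2`). The two therefore coincide.
  have h1 := LinearMap.algHom_comp_convMul_distrib (f : A →ₐ[R] B)
    (WithConv.toConv (HopfAlgebra.antipode R (A := A))) (WithConv.toConv LinearMap.id)
  have h2 := LinearMap.convMul_comp_coalgHom_distrib (WithConv.toConv LinearMap.id)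
    (WithConv.toConv (HopfAlgebra.antipode R (A := B))) (f : A →ₗc[R] B)
  rw [LinearMap.antipode_mul_id] at h1
  rw [LinearMap.id_mul_antipode] at h2
  have h := left_inv_eq_right_inv (WithConv.ofConv_injective (h1.symm.trans ?_))
    (WithConv.ofConv_injective (h2.symm.trans ?_))
  · exact LinearMap.congr_fun (congrArg WithConv.ofConv h) x
  · ext a
    simpa using AlgHomClass.commutes f (Coalgebra.counit (R := R) a)
  · ext a
    simp

/-! ### Compatibility of `Φ` with the Hopf structures -/

section

open PreorderedForest

variable (K : Type*) [CommRing K]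

theorem Phi_mul (x y : Hpo K) : Phi K (x * y) = Phi K x * Phi K y := by
  refine CombAlg.map_mul_of_basis _ (fun a b => ?_) x y
  obtain ⟨n, F, rfl⟩ := exists_cls a
  obtain ⟨m, G, rfl⟩ := exists_cls b
  -- These two bounds put every shifted label of `G` strictly above every label of `F`, as required
  -- both by the preorder of `FG` and by `mul_ofWord`.
  have hF : ∀ v, F.label v ≤ F.max := fun v => by
    have h : F.label v ∈ Set.Icc 1 F.max := F.range_label ▸ Set.mem_range_self v
    exact h.2
  have hG : ∀ w, 1 ≤ G.label w := fun w => by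
    have h : G.label w ∈ Set.Icc 1 G.max := G.range_label ▸ Set.mem_range_self w
    exact h.1
  have hcat : HopfBasis.mul F.cls G.cls = {(F.concat G).cls} :=
    congrArg singleton (POForest.mul_cls F G)
  rw [CombAlg.of_mul_of, hcat, CombAlg.ofM_singleton,
    Phi_of_cls_eq_ofM K (F.concat G) (f := Sum.elim F.label fun w => G.label w + F.max),
    Phi_of_cls_eq_ofM K F F.label_le_label_iff, Phi_of_cls_eq_ofM K G G.label_le_label_iff,
    CombAlg.ofM_mul_ofM, linExts_concat, Multiset.map_bind, Multiset.bind_map]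
  · congr 1
    refine Multiset.bind_congr fun u _ => ?_
    rw [Multiset.map_bind, Multiset.bind_map]
    refine Multiset.bind_congr fun v _ => ?_
    -- For fixed `u` and `v`, the label words of the interleavings are the shufflings of the two
    -- label words, the second one shifted by `F.max`.
    refine Eq.trans ?_ (PackedWord.mul_ofWord (m := F.max) (by simpa using fun v _ => hF v)
      (by simpa using fun v _ => hG v))
    rw [List.map_map, Function.comp_def, ← Interleave.map_interleave, Multiset.map_map]
    rfl
  · rintro (v | v) (w | w)
    · simpa [concat] using F.label_le_label_iff v w
    · have := hF v
      have := hG w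
      simp only [concat, Sum.elim_inl, Sum.elim_inr, Sum.Lex.sep, iff_true]
      omega
    · have := hF w
      have := hG v
      simp only [concat, Sum.elim_inl, Sum.elim_inr, Sum.lex_inr_inl, iff_false, not_le]
      omega
    · simpa [concat] using G.label_le_label_iff v w

open Coalgebra in
theorem comul_Phi (x : Hpo K) :
    TensorProduct.map (Phi K) (Phi K) (comul (R := K) x) = comul (R := K) (Phi K x) := by
  suffices h : TensorProduct.map (Phi K) (Phi K) ∘ₗ comul = comul ∘ₗ Phi K from
    LinearMap.congr_fun h x
  refine CombAlg.hom_ext fun b => ?_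
  obtain ⟨n, F, rfl⟩ := exists_cls b
  have hcut : HopfBasis.comul F.cls = _ := (POForest.comul_cls F).trans F.cutTerms_eq_closed
  -- Taking packed label words on both sides of `linExts_bind_splits` gives the result: one side
  -- becomes the coproduct of `Φ(F)`, the other the image under `Φ ⊗ Φ` of the coproduct of `F`. The
  -- labels of `F` serve for both subforests, by `Phi_of_clsOn`.
  have h := congrArg (Multiset.map fun p => (PackedWord.ofWord (p.1.map F.label),
    PackedWord.ofWord (p.2.map F.label))) F.linExts_bind_splits
  rw [LinearMap.comp_apply, LinearMap.comp_apply, CombAlg.comul_of, hcut,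
    Phi_of_cls_eq_ofM K F F.label_le_label_iff, CombAlg.map_ofM₂, CombAlg.map_ofM]
  simp only [TensorProduct.map_tmul, Phi_of_clsOn, CombAlg.ofM_tmul_ofM, CombAlg.comul_of,
    Multiset.map_map, Function.comp_def, ← CombAlg.ofM₂_bind]
  rw [Multiset.map_bind, Multiset.map_bind] at h
  simp only [Multiset.map_bind, Multiset.map_map, Function.comp_def] at h
  simp only [Multiset.bind_map, ← h]
  congr 1
  refine Multiset.bind_congr fun l _ => ?_
  -- Packing the whole word before cutting it does not change the packings of the two pieces.
  refine Eq.trans ?_ (PackedWord.comul_ofWord _).symm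
  simp [splits, List.map_take, List.map_drop]

theorem Phi_one : Phi K 1 = 1 := by
  have h : (HopfBasis.one : POForest) = empty.cls := rfl
  rw [CombAlg.one_def, h, Phi_of_cls_eq_ofM K empty empty.label_le_label_iff]
  have h' : empty.linExts Set.univ = {[]} := by
    refine (Multiset.Nodup.ext (nodup_linExts _ _) (Multiset.nodup_singleton _)).2 fun l => ?_
    rw [mem_linExts, Multiset.mem_singleton]
    refine ⟨fun _ => List.eq_nil_iff_forall_not_mem.2 fun v => v.elim, ?_⟩
    rintro rfl
    exact ⟨List.nodup_nil, fun v => v.elim, List.Pairwise.nil⟩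
  rw [h', Multiset.map_singleton, CombAlg.ofM_singleton]
  rfl

open Coalgebra in
theorem counit_Phi (x : Hpo K) : counit (R := K) (Phi K x) = counit (R := K) x := by
  suffices h : counit ∘ₗ Phi K = counit from LinearMap.congr_fun h x
  refine CombAlg.hom_ext fun b => ?_
  rw [LinearMap.comp_apply]
  -- In degree `0` the only basis element is the unit. In positive degree every word in `Φ(F)` has
  -- the same positive length, so both counits vanish.
  by_cases hb : HopfBasis.deg b = 0
  · rw [(HopfBasis.deg_eq_zero b).1 hb, ← CombAlg.one_def, Phi_one, Bialgebra.counit_one,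
      Bialgebra.counit_one]
  · rw [CombAlg.counit_of, if_neg hb]
    obtain ⟨n, F, rfl⟩ := exists_cls b
    rw [Phi_of_cls, map_sum]
    refine Finset.sum_eq_zero fun τ hτ => ?_
    have h : HopfBasis.deg τ = HopfBasis.deg F.cls := PackedWord.mem_surj.1 hτ
    rw [map_smul, CombAlg.counit_of, if_neg (h ▸ hb), smul_zero]

theorem Phi_of_mem_component (b : POForest) :
    Phi K (CombAlg.of b) ∈ CombAlg.component K PackedWord (HopfBasis.deg b) := by
  obtain ⟨n, F, rfl⟩ := exists_cls b
  rw [Phi_of_cls]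
  refine Submodule.sum_mem _ fun τ hτ => Submodule.smul_mem _ _ (Submodule.subset_span ?_)
  exact ⟨τ, PackedWord.mem_surj.1 hτ, rfl⟩

/-- `Phi` as a morphism of bialgebras. -/
noncomputable def PhiHom : Hpo K →ₐc[K] WQSymStar K where
  __ := Phi K
  map_smul' := map_smul (Phi K)
  counit_comp := LinearMap.ext (counit_Phi K)
  map_comp_comul := LinearMap.ext (comul_Phi K)
  map_one' := Phi_one K
  map_mul' := Phi_mul K

end

theorem mainTheorem1 (K : Type*) [Field K] [CharZero K] :
    (∃ f : Hpo K →ₐc[K] WQSymStar K, ∀ x, f x = Phi K x) ∧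
      (∀ x, Phi K (HopfAlgebra.antipode K x) = HopfAlgebra.antipode K (Phi K x)) ∧
      ∀ n, (CombAlg.component K POForest n).map (Phi K) ≤ CombAlg.component K PackedWord n := by
  refine ⟨⟨PhiHom K, fun _ => rfl⟩, BialgHom.map_antipode (PhiHom K), fun n => ?_⟩
  rw [CombAlg.component, Submodule.map_span, Submodule.span_le]
  rintro _ ⟨_, ⟨b, rfl, rfl⟩, rfl⟩
  exact Phi_of_mem_component K b
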